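/- Let $N\ge 2$, $0<a<1$ and $1<p<\infty$. Write points of $\mathbb{R}^N$ as $x=(x',x_N)\in\mathbb{R}^{N-1}\times\mathbb{R}$. For a function $\eta:\mathbb{R}^{N-1}\to\mathbb{R}$ let $|\eta|_{0,1}=\sup_{x'\ne y'}|\eta(x')-\eta(y')|/|x'-y'|$. For $\sigma:\mathbb{R}^{N-1}\to(0,\infty)$ and a measurable $f:\mathbb{R}^{N-1}\to\mathbb{R}$ define the screened seminorm $$|f|_{(\sigma)}:=\left(\int_{\mathbb{R}^{N-1}}\int_{B'(0,\sigma(x'))}\frac{|f(x'+h')-f(x')|^p}{|h'|^{p+N-2}}\,dh'\,dx'\right)^{1/p},$$ where $B'(0,r)$ is the open ball of radius $r$ in $\mathbb{R}^{N-1}$ (this is the screened homogeneous fractional Sobolev seminorm of order $s=1-1/p$). For an open set $\Omega\subseteq\mathbb{R}^N$ let $\dot W^{1,p}(\Omega)$ be the space of all $u\in L^1_{\mathrm{loc}}(\Omega)$ whose weak gradient belongs to $L^p(\Omega)$. There is a constant $c=c(a,N,p)>0$ with the following property. Let $\eta^\pm:\mathbb{R}^{N-1}\to\mathbb{R}$ be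 Lipschitz continuous with $\eta^-<\eta^+$ everywhere, put $L:=|\eta^-|_{0,1}+|\eta^+|_{0,1}$ and $$\Omega:=\{x\in\mathbb{R}^N : \eta^-(x')<x_N<\eta^+(x')\},$$ and let $X$ be the vector space of all pairs $(f^-,f^+)$ of functions in $L^p_{\mathrm{loc}}(\mathbb{R}^{N-1})$ such that $$\int_{\mathbb{R}^{N-1}}\frac{|f^+(x')-f^-(x')|^p}{(\eta^+(x')-\eta^-(x'))^{p-1}}\,dx'<\infty,\qquad |f^-|_{(a(\eta^+-\eta^-))}<\infty,\qquad |f^+|_{(a(\eta^+-\eta^-))}<\infty.$$ Then there is a linear map $X\to\dot W^{1,p}(\Omega)$, $(f^-,f^+)\mapsto u$, such that for every $(f^-,f^+)\in X$ the trace of $u$ on $\partial\Omega$ satisfies $\operatorname{Tr}(u)(x',\eta^\pm(x'))=f^\pm(x')$ for almost every $x'\in\mathbb{R}^{N-1}$, and $$\int_\Omega|\nabla u|^p\,dx\le c(1+L)^p\int_{\mathbb{R}^{N-1}}\frac{|f^+(x')-f^-(x')|^p}{(\eta^+(x')-\eta^-(x'))^{p-1}}\,dx'+c(1+L)^p|f^-|^p_{(a(\eta^+-\eta^-))}+c(1+L)^p|f^+|^p_{(a(\eta^+-\eta^-))}.$$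 Here the trace $\operatorname{Tr}(u)\in L^p_{\mathrm{loc}}(\partial\Omega)$ is the ($\mathcal{H}^{N-1}$-almost everywhere unique) function with $$\int_\Omega u\,\partial_i\psi\,dx=-\int_\Omega\psi\,\partial_iu\,dx+\int_{\partial\Omega}\psi\operatorname{Tr}(u)\,\nu_i\,d\mathcal{H}^{N-1}$$ for all $\psi\in C^1_c(\mathbb{R}^N)$ and $i=1,\dots,N$, where $\nu$ is the outward unit normal. -/

import Mathlib

open MeasureTheory Set
open scoped ENNReal NNReal

noncomputable section

/-- The horizontal space `ℝⁿ`, where `n = N - 1`. Points of `ℝᴺ` are pairs `(x', x_N) ∈ ℝⁿ × ℝ`. -/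
abbrev Horiz (n : ℕ) : Type := EuclideanSpace ℝ (Fin n)

/-- Vectors of `ℝᴺ = ℝⁿ × ℝ` with the Euclidean norm and inner product; gradients live here. -/
abbrev EVec (n : ℕ) : Type := WithLp 2 (Horiz n × ℝ)

/-- The Lipschitz seminorm `sup { |η x - η y| / |x - y| : x ≠ y }`, with values in `[0, ∞]`;
`η` is Lipschitz exactly if it is finite. (Pairs `x = y` contribute `0 / 0 = 0`.) -/
def lipSeminorm {n : ℕ} (η : Horiz n → ℝ) : ℝ≥0∞ :=
  ⨆ (x : Horiz n) (y : Horiz n), edist (η x) (η y) / edist x y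

/-- The strip-like domain between the graphs of `ηm` (below) and `ηp` (above). -/
def stripDomain {n : ℕ} (ηm ηp : Horiz n → ℝ) : Set (Horiz n × ℝ) :=
  {x | ηm x.1 < x.2 ∧ x.2 < ηp x.1}

/-- `G` is the weak gradient of `u` on the open set `Ω`: both are locally integrable on `Ω`, and
`∫_Ω u ∂_v φ = - ∫_Ω φ (v · G)` for all test functions `φ ∈ C_c^∞(Ω)` and all directions `v`. -/
def IsWeakGradient {n : ℕ} (Ω : Set (Horiz n × ℝ)) (u : Horiz n × ℝ → ℝ)
    (G : Horiz n × ℝ → EVec n) : Prop :=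
  LocallyIntegrableOn u Ω ∧ LocallyIntegrableOn G Ω ∧
    ∀ φ : Horiz n × ℝ → ℝ, ContDiff ℝ (⊤ : ℕ∞) φ → HasCompactSupport φ → tsupport φ ⊆ Ω →
      ∀ v : Horiz n × ℝ,
        ∫ x in Ω, u x * fderiv ℝ φ x v = - ∫ x in Ω, φ x * inner ℝ (WithLp.toLp 2 v) (G x)

/-- `∫_Ω |G|^p`, with the Euclidean norm of `G`. -/
def gradEnergy {n : ℕ} (p : ℝ) (Ω : Set (Horiz n × ℝ)) (G : Horiz n × ℝ → EVec n) : ℝ≥0∞ :=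
  ∫⁻ x in Ω, ‖G x‖ₑ ^ p

/-- Membership in `L^p_loc(ℝⁿ)`. -/
def MemLpLoc {n : ℕ} (p : ℝ) (f : Horiz n → ℝ) : Prop :=
  ∀ K : Set (Horiz n), IsCompact K → MemLp f (ENNReal.ofReal p) (volume.restrict K)

/-- The `p`-th power of the screened seminorm: the double integral of
`|f(x + h) - f(x)|^p / |h|^(s p + n)` over `x ∈ ℝⁿ` and `h ∈ B(0, σ(x))`. -/
def screenedEnergy {n : ℕ} (s p : ℝ) (σ : Horiz n → ℝ) (f : Horiz n → ℝ) : ℝ≥0∞ :=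
  ∫⁻ x, ∫⁻ h in Metric.ball (0 : Horiz n) (σ x),
    ‖f (x + h) - f x‖ₑ ^ p / ‖h‖ₑ ^ (s * p + n)

/-- The screened homogeneous fractional Sobolev seminorm on `ℝⁿ` with screening function `σ`. -/
def screenedSeminorm {n : ℕ} (s p : ℝ) (σ : Horiz n → ℝ) (f : Horiz n → ℝ) : ℝ≥0∞ :=
  screenedEnergy s p σ f ^ (1 / p)

/-- The weighted difference `∫ |fp - fm|^p / (ηp - ηm)^(p - 1)`. -/
def weightedDiff {n : ℕ} (p : ℝ) (ηm ηp fm fp : Horiz n → ℝ) : ℝ≥0∞ :=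
  ∫⁻ x, ‖fp x - fm x‖ₑ ^ p / ENNReal.ofReal ((ηp x - ηm x) ^ (p - 1))

/-- `u`, with weak gradient `G` on the strip-like domain `Ω`, has the boundary trace
`Tr u (x', ηm x') = fm x'`, `Tr u (x', ηp x') = fp x'`. The trace is the `L^p_loc(∂Ω)` function
that makes the integration by parts formula
`∫_Ω u ∂_v ψ = - ∫_Ω ψ (v · G) + ∫_{∂Ω} ψ (Tr u) (v · ν) dℋ^{N-1}`
true for all `ψ ∈ C_c^1(ℝᴺ)`, which determines it almost everywhere.
In graph coordinates, the vector measure `ν dℋ^{N-1}` (`ν` the outward unit normal) is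
`(-∇ηp, 1) dx'` on the upper graph and `(∇ηm, -1) dx'` on the lower graph. -/
def HasTrace {n : ℕ} (p : ℝ) (ηm ηp : Horiz n → ℝ) (u : Horiz n × ℝ → ℝ)
    (G : Horiz n × ℝ → EVec n) (fm fp : Horiz n → ℝ) : Prop :=
  MemLpLoc p fm ∧ MemLpLoc p fp ∧
  (∀ K : Set (Horiz n × ℝ), IsCompact K → IntegrableOn u (stripDomain ηm ηp ∩ K)) ∧
  (∀ K : Set (Horiz n × ℝ), IsCompact K → IntegrableOn G (stripDomain ηm ηp ∩ K)) ∧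
  ∀ ψ : Horiz n × ℝ → ℝ, ContDiff ℝ 1 ψ → HasCompactSupport ψ → ∀ v : Horiz n × ℝ,
    ∫ x in stripDomain ηm ηp, u x * fderiv ℝ ψ x v =
      - (∫ x in stripDomain ηm ηp, ψ x * inner ℝ (WithLp.toLp 2 v) (G x))
      + (∫ x, ψ (x, ηp x) * fp x * (v.2 - fderiv ℝ ηp x v.1))
      - (∫ x, ψ (x, ηm x) * fm x * (v.2 - fderiv ℝ ηm x v.1))

/-! ### The homogeneous Sobolev space as a vector space -/

theorem integrableOn_mul_of_tsupport_subset {n : ℕ} {Ω : Set (Horiz n × ℝ)}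
    {u ψ : Horiz n × ℝ → ℝ} (hu : LocallyIntegrableOn u Ω) (hψ : Continuous ψ)
    (hc : HasCompactSupport ψ) (hs : tsupport ψ ⊆ Ω) :
    IntegrableOn (fun x => u x * ψ x) Ω := by
  have h1 : IntegrableOn u (tsupport ψ) := hu.integrableOn_compact_subset hs hc
  have h2 : IntegrableOn (fun x => u x * ψ x) (tsupport ψ) :=
    h1.mul_continuousOn hψ.continuousOn hc
  refine ((integrableOn_iff_integrable_of_support_subset ?_).1 h2).integrableOn
  intro x hx
  refine subset_tsupport ψ ?_
  intro h0
  exact hx (by simp [h0])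

theorem IsWeakGradient.linearComb {n : ℕ} {Ω : Set (Horiz n × ℝ)} {u w : Horiz n × ℝ → ℝ}
    {G H : Horiz n × ℝ → EVec n} (hu : IsWeakGradient Ω u G) (hw : IsWeakGradient Ω w H)
    (c : ℝ) : IsWeakGradient Ω (u + c • w) (G + c • H) := by
  refine ⟨hu.1.add (hw.1.smul c), hu.2.1.add (hw.2.1.smul c), ?_⟩
  intro φ hφ hc hs v
  have hd : Continuous fun x => fderiv ℝ φ x v :=
    (hφ.continuous_fderiv (by simp)).clm_apply continuous_const
  have hdc : HasCompactSupport fun x => fderiv ℝ φ x v :=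
    hc.fderiv_apply (𝕜 := ℝ) v
  have hds : tsupport (fun x => fderiv ℝ φ x v) ⊆ Ω :=
    (tsupport_fderiv_apply_subset ℝ v).trans hs
  have key : ∀ K : Horiz n × ℝ → EVec n, LocallyIntegrableOn K Ω →
      IntegrableOn (fun x => φ x * inner ℝ (WithLp.toLp 2 v) (K x)) Ω := by
    intro K hK
    have h1 : LocallyIntegrableOn (fun x => inner ℝ (WithLp.toLp 2 v : EVec n) (K x)) Ω :=
      (innerSL ℝ (WithLp.toLp 2 v : EVec n)).locallyIntegrableOn_comp hK
    have h2 := integrableOn_mul_of_tsupport_subset h1 hφ.continuous hc hs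
    simpa only [mul_comm] using h2
  have e1 := integrableOn_mul_of_tsupport_subset hu.1 hd hdc hds
  have e2 := integrableOn_mul_of_tsupport_subset hw.1 hd hdc hds
  have g1 := key G hu.2.1
  have g2 := key H hw.2.1
  have l1 : (fun x => (u + c • w) x * fderiv ℝ φ x v) =
      fun x => u x * fderiv ℝ φ x v + c * (w x * fderiv ℝ φ x v) := by
    funext x; simp only [Pi.add_apply, Pi.smul_apply, smul_eq_mul]; ring
  have l2 : (fun x => φ x * inner ℝ (WithLp.toLp 2 v : EVec n) ((G + c • H) x)) =
      fun x => φ x * inner ℝ (WithLp.toLp 2 v : EVec n) (G x) +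
        c * (φ x * inner ℝ (WithLp.toLp 2 v : EVec n) (H x)) := by
    funext x; simp only [Pi.add_apply, Pi.smul_apply, inner_add_right, inner_smul_right]; ring
  rw [l1, l2, integral_add e1 (e2.const_mul c), integral_add g1 (g2.const_mul c),
    integral_const_mul, integral_const_mul, hu.2.2 φ hφ hc hs v, hw.2.2 φ hφ hc hs v]
  ring

theorem isWeakGradient_zero {n : ℕ} (Ω : Set (Horiz n × ℝ)) :
    IsWeakGradient Ω (0 : Horiz n × ℝ → ℝ) (0 : Horiz n × ℝ → EVec n) := by
  refine ⟨locallyIntegrableOn_zero, locallyIntegrableOn_zero, ?_⟩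
  intro φ _ _ _ v
  simp

/-- The homogeneous Sobolev space `Ẇ^{1,p}(Ω)`: locally integrable functions on `Ω` whose weak
gradient belongs to `L^p(Ω)`. -/
def homSobolev {n : ℕ} (p : ℝ) (Ω : Set (Horiz n × ℝ)) : Submodule ℝ (Horiz n × ℝ → ℝ) where
  carrier := {u | ∃ G : Horiz n × ℝ → EVec n, IsWeakGradient Ω u G ∧
    MemLp G (ENNReal.ofReal p) (volume.restrict Ω)}
  zero_mem' := ⟨0, isWeakGradient_zero Ω, MemLp.zero⟩
  add_mem' := by
    rintro u w ⟨G, hG, hGp⟩ ⟨H, hH, hHp⟩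
    exact ⟨G + (1 : ℝ) • H, by simpa using hG.linearComb hH 1, hGp.add (hHp.const_smul 1)⟩
  smul_mem' := by
    rintro c u ⟨G, hG, hGp⟩
    exact ⟨0 + c • G, by simpa using (isWeakGradient_zero Ω).linearComb hG c,
      MemLp.zero.add (hGp.const_smul c)⟩

/-! ### The data space as a vector space -/

theorem continuous_of_lipSeminorm_ne_top {n : ℕ} {η : Horiz n → ℝ} (h : lipSeminorm η ≠ ⊤) :
    Continuous η := by
  have hL : LipschitzWith (lipSeminorm η).toNNReal η := by
    intro x y
    rw [ENNReal.coe_toNNReal h]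
    rcases eq_or_ne x y with rfl | hxy
    · simp
    · have h0 : edist x y ≠ 0 := by simpa [edist_eq_zero] using hxy
      rw [← ENNReal.div_le_iff h0 (edist_ne_top x y)]
      exact le_iSup₂ (f := fun x y => edist (η x) (η y) / edist x y) x y
  exact hL.continuous

theorem MemLpLoc.aemeasurable {n : ℕ} {p : ℝ} (hp : 1 < p) {f : Horiz n → ℝ}
    (hf : MemLpLoc p f) : AEMeasurable f := by
  have h : LocallyIntegrable f := by
    rw [locallyIntegrable_iff]
    intro K hK
    have : IsFiniteMeasure (volume.restrict K) := ⟨by simpa using hK.measure_lt_top⟩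
    exact (hf K hK).integrable (by simpa using hp.le)
  exact h.aestronglyMeasurable.aemeasurable

theorem lintegral_rpow_add_div_ne_top {α : Type*} [MeasurableSpace α] {μ : Measure α} {p : ℝ}
    (hp : 1 < p) {F G : α → ℝ} {w : α → ℝ≥0∞} (hF : AEMeasurable F μ) (hw : AEMeasurable w μ)
    (h1 : ∫⁻ x, ‖F x‖ₑ ^ p / w x ∂μ ≠ ⊤) (h2 : ∫⁻ x, ‖G x‖ₑ ^ p / w x ∂μ ≠ ⊤) :
    ∫⁻ x, ‖F x + G x‖ₑ ^ p / w x ∂μ ≠ ⊤ := by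
  have hm : AEMeasurable (fun x => ‖F x‖ₑ ^ p / w x) μ := (hF.enorm.pow_const p).div hw
  have hle : ∫⁻ x, ‖F x + G x‖ₑ ^ p / w x ∂μ ≤
      ∫⁻ x, (2 : ℝ≥0∞) ^ (p - 1) * (‖F x‖ₑ ^ p / w x + ‖G x‖ₑ ^ p / w x) ∂μ := by
    refine lintegral_mono fun x => ?_
    have : ‖F x + G x‖ₑ ^ p ≤ (2 : ℝ≥0∞) ^ (p - 1) * (‖F x‖ₑ ^ p + ‖G x‖ₑ ^ p) :=
      (ENNReal.rpow_le_rpow (enorm_add_le _ _) (by linarith)).trans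
        (ENNReal.rpow_add_le_mul_rpow_add_rpow _ _ hp.le)
    calc ‖F x + G x‖ₑ ^ p / w x ≤ (2 : ℝ≥0∞) ^ (p - 1) * (‖F x‖ₑ ^ p + ‖G x‖ₑ ^ p) / w x := by
          gcongr
      _ = _ := by rw [mul_div_assoc, ENNReal.add_div]
  refine ne_top_of_le_ne_top ?_ hle
  have h2' : (2 : ℝ≥0∞) ^ (p - 1) ≠ ⊤ := by
    simp [ENNReal.rpow_eq_top_iff]
  rw [lintegral_const_mul' _ _ h2', lintegral_add_left' hm]
  exact ENNReal.mul_ne_top h2' (ENNReal.add_ne_top.2 ⟨h1, h2⟩)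

theorem lintegral_rpow_smul_div_ne_top {α : Type*} [MeasurableSpace α] {μ : Measure α} {p : ℝ}
    (hp : 1 < p) {F : α → ℝ} {w : α → ℝ≥0∞} (c : ℝ)
    (h1 : ∫⁻ x, ‖F x‖ₑ ^ p / w x ∂μ ≠ ⊤) :
    ∫⁻ x, ‖c * F x‖ₑ ^ p / w x ∂μ ≠ ⊤ := by
  have hc : ‖c‖ₑ ^ p ≠ ⊤ := ENNReal.rpow_ne_top_of_nonneg (by linarith) enorm_ne_top
  have : ∀ x, ‖c * F x‖ₑ ^ p / w x = ‖c‖ₑ ^ p * (‖F x‖ₑ ^ p / w x) := by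
    intro x
    rw [enorm_mul, ENNReal.mul_rpow_of_nonneg _ _ (by linarith), mul_div_assoc]
  simp only [this]
  rw [lintegral_const_mul' _ _ hc]
  exact ENNReal.mul_ne_top hc h1

theorem aemeasurable_increment {n : ℕ} {f : Horiz n → ℝ} (hf : AEMeasurable f) :
    AEMeasurable (fun z : Horiz n × Horiz n => f (z.1 + z.2) - f z.1)
      (volume.prod volume) := by
  have h1 : Measure.QuasiMeasurePreserving (fun z : Horiz n × Horiz n => z.1 + z.2)
      (volume.prod volume) volume :=
    Measure.quasiMeasurePreserving_snd.comp
      (measurePreserving_prod_add volume volume).quasiMeasurePreserving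
  exact (hf.comp_quasiMeasurePreserving h1).sub
    (hf.comp_quasiMeasurePreserving Measure.quasiMeasurePreserving_fst)

theorem screenedEnergy_eq_lintegral_prod {n : ℕ} {s p : ℝ} {σ f : Horiz n → ℝ}
    (hσ : Continuous σ) (hf : AEMeasurable f) :
    screenedEnergy s p σ f = ∫⁻ z in {z : Horiz n × Horiz n | ‖z.2‖ < σ z.1},
      ‖f (z.1 + z.2) - f z.1‖ₑ ^ p / ‖z.2‖ₑ ^ (s * p + n) ∂(volume.prod volume) := by
  have hS : MeasurableSet {z : Horiz n × Horiz n | ‖z.2‖ < σ z.1} :=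
    (isOpen_lt (by fun_prop) (by fun_prop)).measurableSet
  have hm : AEMeasurable (fun z : Horiz n × Horiz n =>
      ‖f (z.1 + z.2) - f z.1‖ₑ ^ p / ‖z.2‖ₑ ^ (s * p + n)) (volume.prod volume) :=
    ((aemeasurable_increment hf).enorm.pow_const p).div
      (measurable_snd.enorm.pow_const _).aemeasurable
  rw [← lintegral_indicator hS, lintegral_prod _ (hm.indicator hS)]
  refine lintegral_congr fun x => ?_
  rw [← lintegral_indicator Metric.isOpen_ball.measurableSet]
  refine lintegral_congr fun h => ?_
  simp only [indicator, Metric.mem_ball, dist_zero_right, mem_ofPred_eq]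

theorem screenedSeminorm_ne_top_iff {n : ℕ} {s p : ℝ} (hp : 1 < p) {σ f : Horiz n → ℝ} :
    screenedSeminorm s p σ f ≠ ⊤ ↔ screenedEnergy s p σ f ≠ ⊤ := by
  have : 0 < 1 / p := by positivity
  rw [screenedSeminorm, Ne, ENNReal.rpow_eq_top_iff_of_pos this]

theorem screenedSeminorm_add_ne_top {n : ℕ} {s p : ℝ} (hp : 1 < p) {σ f g : Horiz n → ℝ}
    (hσ : Continuous σ) (hf : AEMeasurable f) (hg : AEMeasurable g)
    (h1 : screenedSeminorm s p σ f ≠ ⊤) (h2 : screenedSeminorm s p σ g ≠ ⊤) :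
    screenedSeminorm s p σ (f + g) ≠ ⊤ := by
  rw [screenedSeminorm_ne_top_iff hp] at h1 h2 ⊢
  rw [screenedEnergy_eq_lintegral_prod hσ hf] at h1
  rw [screenedEnergy_eq_lintegral_prod hσ hg] at h2
  rw [screenedEnergy_eq_lintegral_prod hσ (hf.add hg)]
  have := lintegral_rpow_add_div_ne_top hp (aemeasurable_increment hf).restrict
    (measurable_snd.enorm.pow_const _).aemeasurable h1 h2
  convert this using 5 with z
  simp only [Pi.add_apply]; ring_nf

theorem screenedSeminorm_smul_ne_top {n : ℕ} {s p : ℝ} (hp : 1 < p) {σ f : Horiz n → ℝ}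
    (hσ : Continuous σ) (hf : AEMeasurable f) (c : ℝ)
    (h1 : screenedSeminorm s p σ f ≠ ⊤) : screenedSeminorm s p σ (c • f) ≠ ⊤ := by
  rw [screenedSeminorm_ne_top_iff hp] at h1 ⊢
  rw [screenedEnergy_eq_lintegral_prod hσ hf] at h1
  rw [screenedEnergy_eq_lintegral_prod hσ (hf.const_smul c)]
  have := lintegral_rpow_smul_div_ne_top hp c h1
  convert this using 5 with z
  simp only [Pi.smul_apply, smul_eq_mul]; ring_nf

/-- The screening function `a (ηp - ηm)`. -/
def stripScreen {n : ℕ} (a : ℝ) (ηm ηp : Horiz n → ℝ) : Horiz n → ℝ :=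
  fun x => a * (ηp x - ηm x)

/-- The vector space of boundary data `(f⁻, f⁺)`: both functions belong to `L^p_loc(ℝⁿ)`, their
weighted difference is finite, and both have finite screened seminorm of order `s = 1 - 1/p`
with screening function `a (ηp - ηm)`. -/
def boundaryData {n : ℕ} (p a : ℝ) (ηm ηp : Horiz n → ℝ) (hp : 1 < p)
    (hm : lipSeminorm ηm ≠ ⊤) (hq : lipSeminorm ηp ≠ ⊤) :
    Submodule ℝ ((Horiz n → ℝ) × (Horiz n → ℝ)) where
  carrier := {f | MemLpLoc p f.1 ∧ MemLpLoc p f.2 ∧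
    weightedDiff p ηm ηp f.1 f.2 ≠ ⊤ ∧
    screenedSeminorm (1 - 1 / p) p (stripScreen a ηm ηp) f.1 ≠ ⊤ ∧
    screenedSeminorm (1 - 1 / p) p (stripScreen a ηm ηp) f.2 ≠ ⊤}
  zero_mem' := by
    have h0 : (0 : ℝ) < p := by linarith
    have h : screenedSeminorm (1 - 1 / p) p (stripScreen a ηm ηp) (0 : Horiz n → ℝ) ≠ ⊤ := by
      rw [screenedSeminorm_ne_top_iff hp]
      simp [screenedEnergy, h0]
    exact ⟨fun _ _ => MemLp.zero, fun _ _ => MemLp.zero, by simp [weightedDiff, h0], h, h⟩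
  add_mem' := by
    rintro f g ⟨a1, a2, a3, a4, a5⟩ ⟨b1, b2, b3, b4, b5⟩
    have cm := continuous_of_lipSeminorm_ne_top hm
    have cq := continuous_of_lipSeminorm_ne_top hq
    have hσ : Continuous (stripScreen a ηm ηp) := continuous_const.mul (cq.sub cm)
    refine ⟨fun K hK => (a1 K hK).add (b1 K hK), fun K hK => (a2 K hK).add (b2 K hK), ?_,
      screenedSeminorm_add_ne_top hp hσ (a1.aemeasurable hp) (b1.aemeasurable hp) a4 b4,
      screenedSeminorm_add_ne_top hp hσ (a2.aemeasurable hp) (b2.aemeasurable hp) a5 b5⟩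
    have hw : AEMeasurable (fun x => ENNReal.ofReal ((ηp x - ηm x) ^ (p - 1))) :=
      (((cq.sub cm).measurable.pow_const (p - 1)).ennreal_ofReal).aemeasurable
    have := lintegral_rpow_add_div_ne_top hp
      ((a2.aemeasurable hp).sub (a1.aemeasurable hp)) hw a3 b3
    unfold weightedDiff
    convert this using 5 with z
    simp only [Pi.add_apply, Prod.fst_add, Prod.snd_add, Pi.sub_apply]; ring_nf
  smul_mem' := by
    rintro c f ⟨a1, a2, a3, a4, a5⟩
    have cm := continuous_of_lipSeminorm_ne_top hm
    have cq := continuous_of_lipSeminorm_ne_top hq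
    have hσ : Continuous (stripScreen a ηm ηp) := continuous_const.mul (cq.sub cm)
    refine ⟨fun K hK => (a1 K hK).const_smul c, fun K hK => (a2 K hK).const_smul c, ?_,
      screenedSeminorm_smul_ne_top hp hσ (a1.aemeasurable hp) c a4,
      screenedSeminorm_smul_ne_top hp hσ (a2.aemeasurable hp) c a5⟩
    have := lintegral_rpow_smul_div_ne_top hp c a3
    unfold weightedDiff
    convert this using 5 with z
    simp only [Pi.smul_apply, Prod.smul_fst, Prod.smul_snd, smul_eq_mul]; ring_nf

end

/-!
Average `fm`, with a tent-shaped weight, over balls whose radius is `a / 2` times the depth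
`x.2 - ηm x.1` above the lower graph, and `fp` in the same way below the upper graph; then
interpolate the two averages linearly along vertical segments. At depth `r` the derivative of an
average is bounded by the `L¹` oscillation quotient of the function at scale `r`, while the
interpolation contributes the slope `|fp - fm| / (ηp - ηm)`. The energy of the oscillation quotients
is bounded by Hölder's inequality and by integrating first over the depth: this produces exactly the
kernel of the screened energy, and the screening radius appears because the depth never exceeds the
thickness `ηp - ηm`.

The difference quotients of the extension towards the boundary functions are controlled by the same
majorant, hence locally integrable. Cutting off at depth `ε` and letting `ε → 0` therefore turns
integration by parts for locally Lipschitz functions into the trace identity.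
-/

open Filter Topology

noncomputable section

/-! ### Locally Lipschitz functions -/

section Lipschitz

theorem lipschitzWith_mul_of_eq_zero_off {E : Type*} [PseudoMetricSpace E] {s : Set E}
    {w u : E → ℝ} {C D M W : ℝ≥0} (hw : LipschitzWith D w) (hu : LipschitzOnWith C u s)
    (hwW : ∀ x ∈ s, |w x| ≤ W) (huM : ∀ x ∈ s, |u x| ≤ M) (hw0 : ∀ x ∉ s, w x = 0) :
    LipschitzWith (W * C + M * D) fun x => w x * u x := by
  have one_sided : ∀ x ∈ s, ∀ y, |w x - w y| * |u x| ≤ M * D * dist x y := fun x hx y => by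
    have := hw.dist_le_mul x y
    rw [Real.dist_eq] at this
    nlinarith [huM x hx, abs_nonneg (u x), abs_nonneg (w x - w y)]
  refine LipschitzWith.of_dist_le_mul fun x y => ?_
  have hWC : 0 ≤ W * C * dist x y := by positivity
  rw [Real.dist_eq]
  push_cast
  by_cases hx : x ∈ s <;> by_cases hy : y ∈ s
  · have hCu := hu.dist_le_mul x hx y hy
    rw [Real.dist_eq] at hCu
    calc |w x * u x - w y * u y| = |w y * (u x - u y) + (w x - w y) * u x| := by ring_nf
      _ ≤ |w y| * |u x - u y| + |w x - w y| * |u x| := by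
          simpa only [abs_mul] using abs_add_le (w y * (u x - u y)) ((w x - w y) * u x)
      _ ≤ W * (C * dist x y) + M * D * dist x y :=
          add_le_add (by gcongr; exact hwW y hy) (one_sided x hx y)
      _ = (W * C + M * D) * dist x y := by ring
  · have := one_sided x hx y
    simp only [hw0 y hy, sub_zero, zero_mul, abs_mul] at this ⊢
    linarith
  · have := one_sided y hy x
    simp only [hw0 x hx, sub_zero, zero_sub, zero_mul, abs_mul, abs_neg, dist_comm y x]
      at this ⊢
    linarith
  · simp only [hw0 x hx, hw0 y hy, zero_mul, sub_zero, abs_zero]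
    positivity

variable {E : Type*} [NormedAddCommGroup E] [NormedSpace ℝ E]

theorem fderiv_eq_zero_of_eq_zero_off {K : Set E} (hK : IsClosed K) {g : E → ℝ}
    (hg : ∀ x ∉ K, g x = 0) {x : E} (hx : x ∉ K) : fderiv ℝ g x = 0 := by
  have hgx : g =ᶠ[𝓝 x] fun _ => 0 := eventuallyEq_of_mem (hK.isOpen_compl.mem_nhds hx) hg
  rw [hgx.fderiv_eq, fderiv_const_apply]

variable [MeasurableSpace E] [BorelSpace E] {μ : Measure E}

theorem integrable_fderiv_apply_of_lipschitzWith [IsFiniteMeasureOnCompacts μ] {g : E → ℝ}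
    {C : ℝ≥0} (hg : LipschitzWith C g) (hc : HasCompactSupport g) (v : E) :
    Integrable (fun x => fderiv ℝ g x v) μ := by
  refine (integrableOn_iff_integrable_of_support_subset
    (subset_tsupport fun x => fderiv ℝ g x v)).1 ?_
  refine IntegrableOn.of_bound (hc.fderiv_apply (𝕜 := ℝ) v).isCompact.measure_lt_top
    (measurable_fderiv_apply_const ℝ g v).aestronglyMeasurable (C * ‖v‖) ?_
  exact ae_of_all _ fun x => (fderiv ℝ g x).le_of_opNorm_le (norm_fderiv_le_of_lipschitz ℝ hg) v

variable [FiniteDimensional ℝ E] [μ.IsAddHaarMeasure]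

theorem ae_differentiableAt_of_locallyLipschitzOn {Ω : Set E} (hΩ : IsOpen Ω) {u : E → ℝ}
    (hu : LocallyLipschitzOn Ω u) : ∀ᵐ x ∂μ, x ∈ Ω → DifferentiableAt ℝ u x := by
  suffices h : μ {x | x ∈ Ω ∧ ¬ DifferentiableAt ℝ u x} = 0 by
    simpa only [ae_iff, Classical.not_imp] using h
  refine measure_null_of_locally_null _ fun x hx => ?_
  obtain ⟨C, s, hs, hL⟩ := hu hx.1
  rw [hΩ.nhdsWithin_eq hx.1] at hs
  obtain ⟨t, hts, hto, hxt⟩ := mem_nhds_iff.1 hs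
  refine ⟨t ∩ {x | ¬ DifferentiableAt ℝ u x},
    mem_nhdsWithin.2 ⟨t, hto, hxt, fun y hy => ⟨hy.1, hy.2.2⟩⟩, ?_⟩
  have hae := (hL.mono hts).ae_differentiableWithinAt_of_mem (μ := μ)
  refine measure_mono_null ?_ (ae_iff.1 hae)
  rintro y ⟨hyt, hy⟩ h
  exact hy ((h hyt).differentiableAt (hto.mem_nhds hyt))

theorem integral_fderiv_apply_eq_zero {g : E → ℝ} {C : ℝ≥0} (hg : LipschitzWith C g)
    (hc : HasCompactSupport g) (v : E) : ∫ x, fderiv ℝ g x v ∂μ = 0 := by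
  have lineDeriv_one : ∀ x : E, lineDeriv ℝ (fun _ : E => (1 : ℝ)) x (-v) = 0 := by
    simp [lineDeriv]
  have h := (LipschitzWith.const (1 : ℝ) (α := E)).integral_lineDeriv_mul_eq (μ := μ) hg hc (-v)
  simp only [neg_neg, mul_one, lineDeriv_one, zero_mul, integral_zero] at h
  rw [h]
  refine integral_congr_ae ?_
  filter_upwards [hg.ae_differentiableAt (μ := μ)] with x hx
  exact hx.lineDeriv_eq_fderiv.symm

theorem setIntegral_mul_fderiv_eq_neg_of_lipschitzWith {Ω K : Set E} (hΩ : IsOpen Ω)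
    (hK : IsCompact K) (hKΩ : K ⊆ Ω) {u w : E → ℝ} (hu : LocallyLipschitzOn Ω u) {D : ℝ≥0}
    (hw : LipschitzWith D w) (hw0 : ∀ x ∉ K, w x = 0) (v : E) :
    ∫ x in Ω, u x * fderiv ℝ w x v ∂μ = -∫ x in Ω, w x * fderiv ℝ u x v ∂μ := by
  obtain ⟨C, hC⟩ := (hu.mono hKΩ).exists_lipschitzOnWith_of_compact hK
  obtain ⟨M, hM⟩ := hK.exists_bound_of_continuousOn hC.continuousOn
  obtain ⟨W, hW⟩ := hK.exists_bound_of_continuousOn hw.continuous.continuousOn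
  have hwu : LipschitzWith (W.toNNReal * C + M.toNNReal * D) fun x => w x * u x :=
    lipschitzWith_mul_of_eq_zero_off hw hC (fun x hx => (hW x hx).trans W.le_coe_toNNReal)
      (fun x hx => (hM x hx).trans M.le_coe_toNNReal) hw0
  have hwc : HasCompactSupport w := HasCompactSupport.intro hK hw0
  have hwuc : HasCompactSupport fun x => w x * u x := hwc.mul_right
  have int_u : Integrable (fun x => u x * fderiv ℝ w x v) μ := by
    refine (integrableOn_iff_integrable_of_support_subset (s := K) fun x hx => ?_).1
      ((integrable_fderiv_apply_of_lipschitzWith hw hwc v).integrableOn.continuousOn_mul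
        hC.continuousOn hK)
    by_contra hxK
    exact hx (by simp [fderiv_eq_zero_of_eq_zero_off hK.isClosed hw0 hxK])
  have int_wu := integrable_fderiv_apply_of_lipschitzWith (μ := μ) hwu hwuc v
  have product_rule : ∀ᵐ x ∂μ.restrict Ω,
      w x * fderiv ℝ u x v = fderiv ℝ (fun x => w x * u x) x v - u x * fderiv ℝ w x v := by
    filter_upwards [(ae_restrict_iff' hΩ.measurableSet).2
      (ae_differentiableAt_of_locallyLipschitzOn hΩ hu),
      ae_restrict_of_ae hw.ae_differentiableAt] with x hux hwx
    rw [fderiv_fun_mul hwx hux]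
    simp only [add_apply, smul_apply, smul_eq_mul]
    ring
  have integral_wu : ∫ x in Ω, fderiv ℝ (fun x => w x * u x) x v ∂μ = 0 := by
    rw [setIntegral_eq_integral_of_forall_compl_eq_zero fun x hx => by
      rw [fderiv_eq_zero_of_eq_zero_off hK.isClosed (fun y hy => by rw [hw0 y hy, zero_mul])
        fun hxK => hx (hKΩ hxK), zero_apply],
      integral_fderiv_apply_eq_zero hwu hwuc v]
  rw [integral_congr_ae product_rule, integral_sub int_wu.integrableOn int_u.integrableOn,
    integral_wu, zero_sub, neg_neg]

end Lipschitz

/-! ### Depth below or above a graph -/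

/-- The vertical distance to the graph of `η`, multiplied by `c`. The factor `1` measures the depth
above the graph and `-1` the depth below it; `± a / 2` turns depths into averaging radii. -/
def graphDepth {E : Type*} (c : ℝ) (η : E → ℝ) (x : E × ℝ) : ℝ := c * (x.2 - η x.1)

section GraphMeasure

variable {α : Type*} [MeasurableSpace α] {μ : Measure α} {η : α → ℝ} {c : ℝ}

theorem measurable_graphDepth (hη : Measurable η) : Measurable (graphDepth c η) := by
  unfold graphDepth; fun_prop

theorem measurePreserving_graphDepth [SFinite μ] (hη : Measurable η) (hc : c ≠ 0) :
    MeasurePreserving (fun x : α × ℝ => (x.1, graphDepth c η x)) (μ.prod volume)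
      (μ.prod (ENNReal.ofReal |c⁻¹| • volume)) := by
  refine (MeasurePreserving.id μ).skew_product (g := fun y s => c * (s - η y)) ?_
    (ae_of_all _ fun y => ?_)
  · exact measurable_graphDepth hη
  · have hcomp : (fun s => c * (s - η y)) = (fun t => c * t) ∘ fun s => s - η y := rfl
    rw [hcomp, ← Measure.map_map (by fun_prop) (by fun_prop), map_sub_right_eq_self volume (η y),
      Real.map_volume_mul_left hc]

theorem ae_graphDepth_ne [SFinite μ] (hη : Measurable η) (hc : c ≠ 0) (t : ℝ) :
    ∀ᵐ x ∂μ.prod volume, graphDepth c η x ≠ t := by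
  have ht : ∀ᵐ s ∂(ENNReal.ofReal |c⁻¹| • volume : Measure ℝ), s ≠ t :=
    Measure.ae_smul_measure (Measure.ae_ne volume t) _
  exact (measurePreserving_graphDepth hη hc).quasiMeasurePreserving.ae
    (Measure.quasiMeasurePreserving_snd.ae ht)

theorem map_fst_restrict_graphDepth [SFinite μ] (hη : Measurable η) (hc : |c| = 1) {S : Set ℝ}
    (hS : MeasurableSet S) :
    ((μ.prod volume).restrict (graphDepth c η ⁻¹' S)).map Prod.fst = volume S • μ := by
  have hc0 : c ≠ 0 := by rintro rfl; simp at hc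
  have hpre := (measurePreserving_graphDepth (μ := μ) hη hc0).restrict_preimage
    (MeasurableSet.univ.prod hS)
  rw [← Measure.prod_restrict, Measure.restrict_univ, abs_inv, hc] at hpre
  have := congrArg (Measure.map Prod.fst) hpre.map_eq
  rw [Measure.map_map measurable_fst hpre.measurable, Measure.map_fst_prod] at this
  simpa [univ_prod, preimage_preimage, Function.comp_def] using this

theorem integrableOn_graphDepth_fst [SFinite μ] (hη : Measurable η) (hc : |c| = 1) {r t : ℝ}
    {A : α → ℝ} (hA : Integrable A μ) :
    IntegrableOn (fun x : α × ℝ => A x.1) (graphDepth c η ⁻¹' Ioo r t) (μ.prod volume) := by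
  have hmap := map_fst_restrict_graphDepth (μ := μ) hη hc (measurableSet_Ioo (a := r) (b := t))
  refine Integrable.comp_measurable (f := Prod.fst) ?_ measurable_fst
  rw [hmap]
  exact hA.smul_measure (by simp)

theorem setIntegral_graphDepth_fst [SFinite μ] (hη : Measurable η) (hc : |c| = 1) {r t : ℝ}
    (hrt : r ≤ t) {A : α → ℝ} (hA : AEStronglyMeasurable A μ) :
    ∫ x in graphDepth c η ⁻¹' Ioo r t, A x.1 ∂μ.prod volume = (t - r) * ∫ y, A y ∂μ := by
  have hmap := map_fst_restrict_graphDepth (μ := μ) hη hc (measurableSet_Ioo (a := r) (b := t))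
  rw [← integral_map (φ := Prod.fst) measurable_fst.aemeasurable, hmap, integral_smul_measure,
    Real.volume_Ioo, ENNReal.toReal_ofReal (sub_nonneg.2 hrt), smul_eq_mul]
  rw [hmap]
  exact hA.smul_measure _

theorem tendsto_setIntegral_graphDepth_mul (hη : Measurable η) {δ : ℝ} (hδ : 0 < δ)
    {q : α × ℝ → ℝ} (hq : IntegrableOn q (graphDepth c η ⁻¹' Ioo 0 δ) (μ.prod volume)) :
    Tendsto (fun ε => ε⁻¹ * ∫ x in graphDepth c η ⁻¹' Ioo ε (2 * ε),
      graphDepth c η x * q x ∂μ.prod volume) (𝓝[>] 0) (𝓝 0) := by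
  have hmeas : ∀ r t, MeasurableSet (graphDepth c η ⁻¹' Ioo r t) := fun r t =>
    measurable_graphDepth hη measurableSet_Ioo
  let F : ℝ → α × ℝ → ℝ := fun ε =>
    (graphDepth c η ⁻¹' Ioo ε (2 * ε)).indicator fun x => ε⁻¹ * (graphDepth c η x * q x)
  have hF : Tendsto (fun ε => ∫ x in graphDepth c η ⁻¹' Ioo 0 δ, F ε x ∂μ.prod volume)
      (𝓝[>] 0) (𝓝 (∫ _ in graphDepth c η ⁻¹' Ioo 0 δ, (0 : ℝ) ∂μ.prod volume)) := by
    refine tendsto_integral_filter_of_dominated_convergence (fun x => 2 * ‖q x‖) ?_ ?_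
      (hq.norm.const_mul 2) (ae_of_all _ fun x => ?_)
    · refine Eventually.of_forall fun ε => AEStronglyMeasurable.indicator ?_ (hmeas _ _)
      exact ((measurable_graphDepth hη).aestronglyMeasurable.mul
        hq.aestronglyMeasurable).const_mul _
    · filter_upwards [self_mem_nhdsWithin] with ε (hε : 0 < ε)
      refine ae_of_all _ fun x => ?_
      simp only [F, indicator]
      split_ifs with h
      · rw [norm_mul, norm_mul, norm_inv, Real.norm_of_nonneg hε.le,
          Real.norm_of_nonneg (hε.le.trans h.1.le), inv_mul_le_iff₀ hε]
        nlinarith [norm_nonneg (q x), h.2]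
      · simp
    · refine tendsto_const_nhds.congr' ?_
      have away : ∀ᶠ ε in 𝓝[>] (0 : ℝ), 0 < graphDepth c η x → 2 * ε ≤ graphDepth c η x := by
        by_cases hx : 0 < graphDepth c η x
        · filter_upwards [Ioo_mem_nhdsGT (half_pos hx)] with ε hε _ using by linarith [hε.2]
        · exact Eventually.of_forall fun ε h => absurd h hx
      filter_upwards [away, self_mem_nhdsWithin] with ε hx (hε : 0 < ε)
      exact (indicator_of_notMem (fun h => (hx (hε.trans h.1)).not_gt h.2) _).symm
  rw [integral_zero] at hF
  refine hF.congr' ?_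
  filter_upwards [Ioo_mem_nhdsGT (half_pos hδ)] with ε hε
  rw [setIntegral_indicator (hmeas _ _), inter_eq_right.2, integral_const_mul]
  exact preimage_mono (Ioo_subset_Ioo hε.1.le (by linarith [hε.2]))

theorem tendsto_setIntegral_graphDepth [SFinite μ] (hη : Measurable η) (hc : |c| = 1) {δ : ℝ}
    (hδ : 0 < δ) {A : α → ℝ} (hA : Integrable A μ) {Φ q : α × ℝ → ℝ}
    (hq : IntegrableOn q (graphDepth c η ⁻¹' Ioo 0 δ) (μ.prod volume))
    (hΦ : ∀ x, graphDepth c η x ∈ Ioo 0 δ → Φ x = A x.1 + graphDepth c η x * q x) :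
    Tendsto (fun ε => ε⁻¹ * ∫ x in graphDepth c η ⁻¹' Ioo ε (2 * ε), Φ x ∂μ.prod volume)
      (𝓝[>] 0) (𝓝 (∫ y, A y ∂μ)) := by
  have hlim := (tendsto_setIntegral_graphDepth_mul (c := c) (μ := μ) hη hδ hq).const_add
    (∫ y, A y ∂μ)
  rw [add_zero] at hlim
  refine hlim.congr' ?_
  filter_upwards [Ioo_mem_nhdsGT (half_pos hδ)] with ε hε
  have hmeas : MeasurableSet (graphDepth c η ⁻¹' Ioo ε (2 * ε)) :=
    measurable_graphDepth hη measurableSet_Ioo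
  have hsub : Ioo ε (2 * ε) ⊆ Ioo 0 δ := Ioo_subset_Ioo hε.1.le (by linarith [hε.2])
  have hqε : IntegrableOn (fun x => graphDepth c η x * q x) (graphDepth c η ⁻¹' Ioo ε (2 * ε))
      (μ.prod volume) := by
    refine (hq.mono_set (preimage_mono hsub)).bdd_mul (c := 2 * ε)
      (measurable_graphDepth hη).aestronglyMeasurable ?_
    filter_upwards [ae_restrict_mem hmeas] with x hx
    rw [Real.norm_of_nonneg (hε.1.le.trans hx.1.le)]
    exact hx.2.le
  rw [setIntegral_congr_fun hmeas fun x hx => hΦ x (hsub hx),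
    integral_add (integrableOn_graphDepth_fst hη hc hA) hqε,
    setIntegral_graphDepth_fst hη hc (by linarith [hε.1]) hA.aestronglyMeasurable]
  field_simp [hε.1.ne']
  ring

end GraphMeasure

section GraphDepth

variable {E : Type*} {η : E → ℝ} {c : ℝ}

theorem lipschitzWith_graphDepth [PseudoMetricSpace E] {Λ : ℝ≥0} (hη : LipschitzWith Λ η) :
    LipschitzWith (‖c‖₊ * (1 + Λ)) (graphDepth c η) := by
  have h := LipschitzWith.prod_snd.sub (hη.comp LipschitzWith.prod_fst)
  rw [mul_one] at h
  exact (lipschitzWith_smul c).comp h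

theorem continuous_graphDepth [TopologicalSpace E] (hη : Continuous η) :
    Continuous (graphDepth c η) := by
  unfold graphDepth; fun_prop

variable [NormedAddCommGroup E] [NormedSpace ℝ E]

/-- The component of `v` along the vector `(-∇η, 1)` normal to the graph of `η`, whose integral in
graph coordinates is the flux of `v` through the graph. -/
def graphFlux (η : E → ℝ) (v : E × ℝ) (y : E) : ℝ := v.2 - fderiv ℝ η y v.1

theorem measurable_graphFlux [MeasurableSpace E] [OpensMeasurableSpace E] (v : E × ℝ) :
    Measurable (graphFlux η v) :=
  (measurable_fderiv_apply_const ℝ η v.1).const_sub v.2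

theorem abs_graphFlux_le {Λ : ℝ≥0} (hη : LipschitzWith Λ η) (v : E × ℝ) (y : E) :
    |graphFlux η v y| ≤ |v.2| + Λ * ‖v.1‖ :=
  (abs_sub _ _).trans <| add_le_add_right
    ((fderiv ℝ η y).le_of_opNorm_le (norm_fderiv_le_of_lipschitz ℝ hη) v.1) _

theorem hasFDerivAt_graphDepth {x : E × ℝ} (h : DifferentiableAt ℝ η x.1) :
    HasFDerivAt (graphDepth c η) (c • (ContinuousLinearMap.snd ℝ E ℝ -
      (fderiv ℝ η x.1).comp (ContinuousLinearMap.fst ℝ E ℝ))) x :=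
  (hasFDerivAt_snd.sub (h.hasFDerivAt.comp x hasFDerivAt_fst)).const_smul c

end GraphDepth

section Ramp

/-- The piecewise linear function that is `0` up to `1` and `1` from `2` on. -/
def ramp (s : ℝ) : ℝ := max 0 (min 1 (s - 1))

theorem ramp_nonneg (s : ℝ) : 0 ≤ ramp s := le_max_left _ _

theorem ramp_le_one (s : ℝ) : ramp s ≤ 1 := max_le zero_le_one (min_le_left _ _)

theorem ramp_eq_zero {s : ℝ} (h : s ≤ 1) : ramp s = 0 :=
  max_eq_left ((min_le_right _ _).trans (by linarith))

theorem ramp_eq_one {s : ℝ} (h : 2 ≤ s) : ramp s = 1 := by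
  rw [ramp, min_eq_left (by linarith), max_eq_right zero_le_one]

theorem lipschitzWith_ramp : LipschitzWith 1 ramp := by
  have h : LipschitzWith 1 fun s : ℝ => s - 1 := LipschitzWith.of_dist_le_mul (by simp)
  exact (h.const_min 1).const_max 0

theorem hasDerivAt_ramp {s : ℝ} (h1 : s ≠ 1) (h2 : s ≠ 2) :
    HasDerivAt ramp ((Ioo 1 2).indicator 1 s) s := by
  rcases lt_or_gt_of_ne h1 with h | h
  · rw [indicator_of_notMem fun hs => h.not_gt hs.1]
    refine (hasDerivAt_const s (0 : ℝ)).congr_of_eventuallyEq ?_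
    filter_upwards [Iio_mem_nhds h] with t ht using ramp_eq_zero (le_of_lt ht)
  · rcases lt_or_gt_of_ne h2 with h' | h'
    · rw [indicator_of_mem (show s ∈ Ioo 1 2 from ⟨h, h'⟩)]
      refine ((hasDerivAt_id s).sub_const 1).congr_of_eventuallyEq ?_
      filter_upwards [Ioo_mem_nhds h h'] with t ht
      rw [ramp, min_eq_right (by linarith [ht.2]), max_eq_right (by linarith [ht.1])]; rfl
    · rw [indicator_of_notMem fun hs => h'.not_gt hs.2]
      refine (hasDerivAt_const s (1 : ℝ)).congr_of_eventuallyEq ?_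
      filter_upwards [Ioi_mem_nhds h'] with t ht using ramp_eq_one (le_of_lt ht)

/-- The cutoff that vanishes up to depth `ε` and is `1` from depth `2 * ε` on. -/
def graphCutoff {E : Type*} (c : ℝ) (η : E → ℝ) (ε : ℝ) (x : E × ℝ) : ℝ :=
  ramp (ε⁻¹ * graphDepth c η x)

variable {E : Type*} {η : E → ℝ} {c ε : ℝ}

theorem graphCutoff_eq_zero (hε : 0 < ε) {x : E × ℝ} (hx : graphDepth c η x ≤ ε) :
    graphCutoff c η ε x = 0 :=
  ramp_eq_zero ((inv_mul_le_iff₀ hε).2 (by linarith))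

theorem graphCutoff_eq_one (hε : 0 < ε) {x : E × ℝ} (hx : 2 * ε ≤ graphDepth c η x) :
    graphCutoff c η ε x = 1 :=
  ramp_eq_one ((le_inv_mul_iff₀ hε).2 (by linarith))

theorem lipschitzWith_graphCutoff [PseudoMetricSpace E] {Λ : ℝ≥0} (hη : LipschitzWith Λ η) :
    LipschitzWith (1 * (‖ε⁻¹‖₊ * (‖c‖₊ * (1 + Λ)))) (graphCutoff c η ε) :=
  lipschitzWith_ramp.comp ((lipschitzWith_smul ε⁻¹).comp (lipschitzWith_graphDepth hη))

variable [NormedAddCommGroup E] [NormedSpace ℝ E] [FiniteDimensional ℝ E] [MeasurableSpace E]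
  [BorelSpace E] {μ : Measure E} [μ.IsAddHaarMeasure]

theorem ae_fderiv_graphCutoff_apply {Λ : ℝ≥0} (hη : LipschitzWith Λ η) (hc : c ≠ 0)
    (hε : 0 < ε) (v : E × ℝ) : ∀ᵐ x ∂μ.prod volume,
      DifferentiableAt ℝ (graphCutoff c η ε) x ∧ fderiv ℝ (graphCutoff c η ε) x v =
        (graphDepth c η ⁻¹' Ioo ε (2 * ε)).indicator
          (fun x => ε⁻¹ * (c * graphFlux η v x.1)) x := by
  have hηm := hη.continuous.measurable
  filter_upwards [Measure.quasiMeasurePreserving_fst.ae (hη.ae_differentiableAt (μ := μ)),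
    ae_graphDepth_ne hηm hc ε, ae_graphDepth_ne hηm hc (2 * ε)] with x hx h1 h2
  have hmem : ε⁻¹ * graphDepth c η x ∈ Ioo 1 2 ↔ graphDepth c η x ∈ Ioo ε (2 * ε) := by
    rw [mem_Ioo, mem_Ioo, lt_inv_mul_iff₀ hε, inv_mul_lt_iff₀ hε, mul_one, mul_comm ε]
  have hd : HasFDerivAt (graphCutoff c η ε) _ x := (hasDerivAt_ramp (s := ε⁻¹ * graphDepth c η x)
    (fun h => h1 (by field_simp at h; linarith))
    (fun h => h2 (by field_simp at h; linarith))).comp_hasFDerivAt x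
      ((hasFDerivAt_graphDepth hx).const_smul ε⁻¹)
  refine ⟨hd.differentiableAt, ?_⟩
  rw [hd.fderiv]
  by_cases h : graphDepth c η x ∈ Ioo ε (2 * ε)
  · rw [indicator_of_mem (hmem.2 h), indicator_of_mem (mem_preimage.2 h)]
    simp [graphFlux]
  · rw [indicator_of_notMem (mt hmem.1 h), indicator_of_notMem (mt mem_preimage.1 h)]
    simp

end Ramp

/-! ### Traces of locally Lipschitz functions -/

section LayerTrace

variable {n : ℕ} {η : Horiz n → ℝ} {c : ℝ} {Λ : ℝ≥0} {f : Horiz n → ℝ} {ψ : Horiz n × ℝ → ℝ}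

theorem isCompact_fst_image_tsupport (hψc : HasCompactSupport ψ) :
    IsCompact (Prod.fst '' tsupport ψ) := hψc.isCompact.image continuous_fst

theorem eq_zero_of_fst_notMem_image_tsupport {x : Horiz n × ℝ}
    (hx : x.1 ∉ Prod.fst '' tsupport ψ) (s : ℝ) : ψ (x.1, s) = 0 :=
  image_eq_zero_of_notMem_tsupport fun h => hx ⟨_, h, rfl⟩

theorem integrable_mul_graphFlux_comp {X : Type*} [MeasurableSpace X] {ν : Measure X}
    (hη : LipschitzWith Λ η) (v : Horiz n × ℝ) {g : X → ℝ} (hg : Integrable g ν)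
    {π : X → Horiz n} (hπ : Measurable π) :
    Integrable (fun x => g x * graphFlux η v (π x)) ν :=
  hg.mul_bdd (c := |v.2| + Λ * ‖v.1‖)
    ((measurable_graphFlux v).comp hπ).aestronglyMeasurable
    (ae_of_all _ fun _ => abs_graphFlux_le hη v _)

theorem integrable_mul_comp_graph (hη : Continuous η) (hf : LocallyIntegrable f)
    (hψ : Continuous ψ) (hψc : HasCompactSupport ψ) :
    Integrable fun y => ψ (y, η y) * f y :=
  hf.integrable_smul_left_of_hasCompactSupport (by fun_prop)
    (HasCompactSupport.intro (isCompact_fst_image_tsupport hψc) fun y hy =>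
      eq_zero_of_fst_notMem_image_tsupport (x := (y, η y)) hy _)

theorem integrableOn_mul_vertical_quotient (hη : Continuous η) (hc : |c| = 1)
    (hf : LocallyIntegrable f) {D : ℝ≥0} (hψ : LipschitzWith D ψ) (hψc : HasCompactSupport ψ)
    (δ : ℝ) : IntegrableOn (fun x => f x.1 * ((ψ x - ψ (x.1, η x.1)) / graphDepth c η x))
      (graphDepth c η ⁻¹' Ioo 0 δ) := by
  have hK := isCompact_fst_image_tsupport hψc
  have hind : IntegrableOn (fun x : Horiz n × ℝ => (Prod.fst '' tsupport ψ).indicator f x.1)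
      (graphDepth c η ⁻¹' Ioo 0 δ) :=
    integrableOn_graphDepth_fst hη.measurable hc
      ((hf.integrableOn_isCompact hK).integrable_indicator hK.measurableSet)
  have hψm := hψ.continuous.measurable
  have hηm := hη.measurable
  have hquot : ∀ x, ‖(ψ x - ψ (x.1, η x.1)) / graphDepth c η x‖ ≤ D := fun x => by
    have hdist := hψ.dist_le_mul x (x.1, η x.1)
    rw [Prod.dist_eq, dist_self, max_eq_right dist_nonneg, Real.dist_eq, Real.dist_eq] at hdist
    rw [norm_div, Real.norm_eq_abs, Real.norm_eq_abs, graphDepth, abs_mul, hc, one_mul]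
    exact div_le_of_le_mul₀ (abs_nonneg _) D.coe_nonneg hdist
  refine (hind.mul_bdd (c := D) (g := fun x => (ψ x - ψ (x.1, η x.1)) / graphDepth c η x) ?_
    (ae_of_all _ hquot)).congr (ae_of_all _ fun x => ?_)
  · exact ((hψm.sub (hψm.comp (measurable_fst.prodMk (hηm.comp measurable_fst)))).div
      (measurable_graphDepth hηm)).aestronglyMeasurable
  · by_cases hx : x.1 ∈ Prod.fst '' tsupport ψ
    · simp only [indicator_of_mem hx]
    · simp only [eq_zero_of_fst_notMem_image_tsupport hx, sub_self, zero_div, mul_zero]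

theorem tendsto_setIntegral_layer_trace (hη : LipschitzWith Λ η) (hc : |c| = 1)
    (hf : LocallyIntegrable f) (hψ : ContDiff ℝ 1 ψ) (hψc : HasCompactSupport ψ)
    (v : Horiz n × ℝ) {Ω : Set (Horiz n × ℝ)} {δ : ℝ} (hδ : 0 < δ)
    (hΩ : ∀ x, x.1 ∈ Prod.fst '' tsupport ψ → graphDepth c η x ∈ Ioo 0 δ → x ∈ Ω)
    {u : Horiz n × ℝ → ℝ}
    (hu : LocallyIntegrable (fun x => (u x - f x.1) / graphDepth c η x) (volume.restrict Ω)) :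
    Tendsto (fun ε => ε⁻¹ * ∫ x in graphDepth c η ⁻¹' Ioo ε (2 * ε),
      ψ x * u x * graphFlux η v x.1) (𝓝[>] 0)
      (𝓝 (∫ y, ψ (y, η y) * f y * graphFlux η v y)) := by
  obtain ⟨D, hD⟩ := hψ.lipschitzWith_of_hasCompactSupport hψc one_ne_zero
  have hψ_zero : ∀ x ∈ graphDepth c η ⁻¹' Ioo 0 δ \ Ω, ψ x = 0 := fun x hx =>
    eq_zero_of_fst_notMem_image_tsupport (x := x) (fun h => hx.2 (hΩ x h hx.1)) x.2
  have hquot : IntegrableOn (fun x => ψ x * ((u x - f x.1) / graphDepth c η x))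
      (graphDepth c η ⁻¹' Ioo 0 δ) :=
    IntegrableOn.of_forall_sdiff_eq_zero
      (hu.integrable_smul_left_of_hasCompactSupport hψ.continuous hψc)
      (measurable_graphDepth hη.continuous.measurable measurableSet_Ioo)
      fun x hx => by rw [hψ_zero x hx, zero_mul]
  refine tendsto_setIntegral_graphDepth hη.continuous.measurable hc hδ
    (integrable_mul_graphFlux_comp hη v
      (integrable_mul_comp_graph hη.continuous hf hψ.continuous hψc) measurable_id)
    (integrable_mul_graphFlux_comp hη v
      (hquot.add (integrableOn_mul_vertical_quotient hη.continuous hc hf hD hψc δ))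
      measurable_fst) fun x hx => ?_
  have hτ : graphDepth c η x ≠ 0 := hx.1.ne'
  simp only [Pi.add_apply, id]
  field_simp
  ring

end LayerTrace

section Strip

variable {n : ℕ} {ηm ηp : Horiz n → ℝ}

theorem mem_stripDomain_iff {x : Horiz n × ℝ} :
    x ∈ stripDomain ηm ηp ↔ 0 < graphDepth 1 ηm x ∧ 0 < graphDepth (-1) ηp x := by
  simp [stripDomain, graphDepth]

theorem graphDepth_add_graphDepth (x : Horiz n × ℝ) :
    graphDepth 1 ηm x + graphDepth (-1) ηp x = ηp x.1 - ηm x.1 := by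
  simp only [graphDepth]; ring

theorem isOpen_stripDomain (hm : Continuous ηm) (hp : Continuous ηp) :
    IsOpen (stripDomain ηm ηp) := by
  simp only [stripDomain, ofPred_and]
  exact (isOpen_lt (by fun_prop) (by fun_prop)).inter (isOpen_lt (by fun_prop) (by fun_prop))

instance isAddHaarMeasure_volume_horiz_prod (n : ℕ) :
    (volume : Measure (Horiz n × ℝ)).IsAddHaarMeasure :=
  inferInstanceAs (volume.prod volume).IsAddHaarMeasure

theorem locallyIntegrable_comp_fst {f : Horiz n → ℝ} (hf : LocallyIntegrable f) :
    LocallyIntegrable fun x : Horiz n × ℝ => f x.1 := by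
  refine locallyIntegrable_iff.2 fun K hK => ?_
  have h2 : IsFiniteMeasure ((volume : Measure ℝ).restrict (Prod.snd '' K)) :=
    ⟨by simpa using (hK.image continuous_snd).measure_lt_top⟩
  have hprod := (hf.integrableOn_isCompact (hK.image continuous_fst)).comp_fst
    (volume.restrict (Prod.snd '' K))
  rw [Measure.prod_restrict] at hprod
  exact IntegrableOn.mono_set (t := (Prod.fst '' K) ×ˢ (Prod.snd '' K)) hprod
    fun x hx => ⟨mem_image_of_mem _ hx, mem_image_of_mem _ hx⟩

/-- The cutoff that removes the points of depth at most `ε` below the upper or above the lower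
graph. It is meant for points over which the strip is thicker than `4 * ε`: there at least one of
the two summands is `1`, so that this sum agrees with their product. -/
def stripCutoff (ηm ηp : Horiz n → ℝ) (ε : ℝ) (x : Horiz n × ℝ) : ℝ :=
  graphCutoff 1 ηm ε x + graphCutoff (-1) ηp ε x - 1

theorem abs_stripCutoff_le_one (ε : ℝ) (x : Horiz n × ℝ) : |stripCutoff ηm ηp ε x| ≤ 1 := by
  have hm := ramp_nonneg (ε⁻¹ * graphDepth 1 ηm x)
  have hm' := ramp_le_one (ε⁻¹ * graphDepth 1 ηm x)
  have hp := ramp_nonneg (ε⁻¹ * graphDepth (-1) ηp x)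
  have hp' := ramp_le_one (ε⁻¹ * graphDepth (-1) ηp x)
  rw [stripCutoff, graphCutoff, graphCutoff, abs_le]
  constructor <;> linarith

theorem stripCutoff_eq_zero {ε : ℝ} (hε : 0 < ε) {x : Horiz n × ℝ}
    (hthick : 4 * ε ≤ ηp x.1 - ηm x.1)
    (hx : graphDepth 1 ηm x ≤ ε ∨ graphDepth (-1) ηp x ≤ ε) : stripCutoff ηm ηp ε x = 0 := by
  have hsum := graphDepth_add_graphDepth (ηm := ηm) (ηp := ηp) x
  rw [stripCutoff]
  rcases hx with h | h
  · rw [graphCutoff_eq_zero hε h, graphCutoff_eq_one hε (by linarith)]; ring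
  · rw [graphCutoff_eq_one hε (by linarith), graphCutoff_eq_zero hε h]; ring

theorem tendsto_stripCutoff {x : Horiz n × ℝ} (hx : x ∈ stripDomain ηm ηp) :
    Tendsto (fun ε => stripCutoff ηm ηp ε x) (𝓝[>] 0) (𝓝 1) := by
  rw [mem_stripDomain_iff] at hx
  refine tendsto_const_nhds.congr' ?_
  filter_upwards [Ioo_mem_nhdsGT (half_pos hx.1), Ioo_mem_nhdsGT (half_pos hx.2)] with ε hm hp
  rw [stripCutoff, graphCutoff_eq_one hm.1 (by linarith [hm.2]),
    graphCutoff_eq_one hm.1 (by linarith [hp.2])]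
  ring

variable {Λm Λp : ℝ≥0}

theorem exists_lipschitzWith_stripCutoff (hm : LipschitzWith Λm ηm) (hp : LipschitzWith Λp ηp)
    (ε : ℝ) : ∃ C, LipschitzWith C (stripCutoff ηm ηp ε) :=
  ⟨_, ((lipschitzWith_graphCutoff hm).add (lipschitzWith_graphCutoff hp)).sub
    (LipschitzWith.const 1)⟩

theorem ae_fderiv_mul_stripCutoff_apply (hm : LipschitzWith Λm ηm) (hp : LipschitzWith Λp ηp)
    {ε : ℝ} (hε : 0 < ε) {ψ : Horiz n × ℝ → ℝ} (hψ : Differentiable ℝ ψ) (v : Horiz n × ℝ) :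
    ∀ᵐ x, fderiv ℝ (fun x => stripCutoff ηm ηp ε x * ψ x) x v =
      stripCutoff ηm ηp ε x * fderiv ℝ ψ x v + ε⁻¹ *
        ((graphDepth 1 ηm ⁻¹' Ioo ε (2 * ε)).indicator (fun x => ψ x * graphFlux ηm v x.1) x -
        (graphDepth (-1) ηp ⁻¹' Ioo ε (2 * ε)).indicator
          (fun x => ψ x * graphFlux ηp v x.1) x) := by
  filter_upwards [ae_fderiv_graphCutoff_apply (μ := volume) hm one_ne_zero hε v,
    ae_fderiv_graphCutoff_apply (μ := volume) hp (neg_ne_zero.2 one_ne_zero) hε v]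
    with x ⟨hdm, hvm⟩ ⟨hdp, hvp⟩
  have hcut : HasFDerivAt (stripCutoff ηm ηp ε) _ x :=
    (hdm.hasFDerivAt.add hdp.hasFDerivAt).sub_const 1
  have hprod : HasFDerivAt (fun x => stripCutoff ηm ηp ε x * ψ x) _ x :=
    hcut.mul (hψ x).hasFDerivAt
  rw [hprod.fderiv]
  simp only [add_apply, smul_apply, hvm, hvp, indicator, smul_eq_mul]
  split_ifs <;> ring

theorem setIntegral_mul_fderiv_mul_stripCutoff (hm : LipschitzWith Λm ηm)
    (hp : LipschitzWith Λp ηp) {ψ : Horiz n × ℝ → ℝ} (hψ : ContDiff ℝ 1 ψ)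
    (hψc : HasCompactSupport ψ) {ε : ℝ} (hε : 0 < ε)
    (hthick : ∀ x ∈ tsupport ψ, 4 * ε ≤ ηp x.1 - ηm x.1) {u : Horiz n × ℝ → ℝ}
    (hu : LocallyLipschitzOn (stripDomain ηm ηp) u) (v : Horiz n × ℝ) :
    ∫ x in stripDomain ηm ηp, u x * fderiv ℝ (fun x => stripCutoff ηm ηp ε x * ψ x) x v =
      -∫ x in stripDomain ηm ηp, stripCutoff ηm ηp ε x * ψ x * fderiv ℝ u x v := by
  obtain ⟨C, hC⟩ := exists_lipschitzWith_stripCutoff hm hp ε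
  obtain ⟨D, hD⟩ := hψ.lipschitzWith_of_hasCompactSupport hψc one_ne_zero
  obtain ⟨M, hM⟩ := hψc.exists_bound_of_continuous hψ.continuous
  have hw := lipschitzWith_mul_of_eq_zero_off (s := univ) (W := 1) hC hD.lipschitzOnWith
    (fun x _ => abs_stripCutoff_le_one ε x) (fun x _ => (hM x).trans M.le_coe_toNNReal) (by simp)
  have hτm := continuous_graphDepth (c := 1) hm.continuous
  have hτp := continuous_graphDepth (c := -1) hp.continuous
  refine setIntegral_mul_fderiv_eq_neg_of_lipschitzWith
    (K := tsupport ψ ∩ {x | ε ≤ graphDepth 1 ηm x} ∩ {x | ε ≤ graphDepth (-1) ηp x})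
    (isOpen_stripDomain hm.continuous hp.continuous)
    ((hψc.isCompact.inter_right (isClosed_le continuous_const hτm)).inter_right
      (isClosed_le continuous_const hτp))
    (fun x hx => mem_stripDomain_iff.2 ⟨hε.trans_le hx.1.2, hε.trans_le hx.2⟩) hu hw
    (fun x hx => ?_) v
  by_cases hxψ : x ∈ tsupport ψ
  · rw [stripCutoff_eq_zero hε (hthick x hxψ), zero_mul]
    by_contra! h
    exact hx ⟨⟨hxψ, h.1.le⟩, h.2.le⟩
  · rw [image_eq_zero_of_notMem_tsupport hxψ, mul_zero]

end Strip

section Trace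

variable {n : ℕ} {ηm ηp : Horiz n → ℝ} {Λm Λp : ℝ≥0} {u ψ : Horiz n × ℝ → ℝ}

theorem integrable_mul_fderiv_add (hψ : ContDiff ℝ 1 ψ) (hψc : HasCompactSupport ψ)
    {μ : Measure (Horiz n × ℝ)} (hu : LocallyIntegrable u μ)
    (hdu : LocallyIntegrable (fderiv ℝ u) μ) (v : Horiz n × ℝ) :
    Integrable (fun x => fderiv ℝ ψ x v * u x) μ ∧ Integrable (fun x => ψ x * fderiv ℝ u x v) μ :=
  ⟨hu.integrable_smul_left_of_hasCompactSupport
    ((hψ.continuous_fderiv one_ne_zero).clm_apply continuous_const) (hψc.fderiv_apply (𝕜 := ℝ) v),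
  (hdu.integrable_smul_left_of_hasCompactSupport hψ.continuous hψc).apply_continuousLinearMap v⟩

theorem eq_zero_of_graphDepth_mem_Ioo {ε : ℝ}
    (hthick : ∀ x ∈ tsupport ψ, 4 * ε ≤ ηp x.1 - ηm x.1) {x : Horiz n × ℝ}
    (hx : x ∉ stripDomain ηm ηp)
    (hlayer : graphDepth 1 ηm x ∈ Ioo ε (2 * ε) ∨ graphDepth (-1) ηp x ∈ Ioo ε (2 * ε)) :
    ψ x = 0 := by
  by_contra h
  have hd := hthick x (subset_tsupport ψ h)
  have hsum := graphDepth_add_graphDepth (ηm := ηm) (ηp := ηp) x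
  refine hx (mem_stripDomain_iff.2 ?_)
  rcases hlayer with hl | hl <;> constructor <;> linarith [hl.1, hl.2]

theorem integral_layer_indicator {Λ : ℝ≥0} {η : Horiz n → ℝ} (hη : LipschitzWith Λ η)
    (hψ : Continuous ψ) (hψc : HasCompactSupport ψ) {Ω : Set (Horiz n × ℝ)}
    (hui : LocallyIntegrable u (volume.restrict Ω)) (v : Horiz n × ℝ) {c ε : ℝ}
    (hzero : ∀ x ∉ Ω, graphDepth c η x ∈ Ioo ε (2 * ε) → ψ x = 0) :
    IntegrableOn ((graphDepth c η ⁻¹' Ioo ε (2 * ε)).indicator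
      fun x => ψ x * u x * graphFlux η v x.1) Ω ∧
    ∫ x in Ω, (graphDepth c η ⁻¹' Ioo ε (2 * ε)).indicator
        (fun x => ψ x * u x * graphFlux η v x.1) x =
      ∫ x in graphDepth c η ⁻¹' Ioo ε (2 * ε), ψ x * u x * graphFlux η v x.1 := by
  have hL : MeasurableSet (graphDepth c η ⁻¹' Ioo ε (2 * ε)) :=
    measurable_graphDepth hη.continuous.measurable measurableSet_Ioo
  refine ⟨(integrable_mul_graphFlux_comp hη v
    (hui.integrable_smul_left_of_hasCompactSupport hψ hψc) measurable_fst).indicator hL, ?_⟩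
  rw [setIntegral_indicator hL]
  refine (setIntegral_eq_of_subset_of_forall_sdiff_eq_zero hL inter_subset_right
    fun x hx => ?_).symm
  rw [hzero x (fun h => hx.2 ⟨h, hx.1⟩) hx.1, zero_mul, zero_mul]

theorem integrableOn_stripCutoff_mul (hm : LipschitzWith Λm ηm) (hp : LipschitzWith Λp ηp)
    (ε : ℝ) {g : Horiz n × ℝ → ℝ} {Ω : Set (Horiz n × ℝ)} (hg : IntegrableOn g Ω) :
    IntegrableOn (fun x => stripCutoff ηm ηp ε x * g x) Ω := by
  obtain ⟨C, hC⟩ := exists_lipschitzWith_stripCutoff hm hp ε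
  exact hg.bdd_mul hC.continuous.aestronglyMeasurable (ae_of_all _ (abs_stripCutoff_le_one ε))

theorem setIntegral_stripCutoff_mul (hm : LipschitzWith Λm ηm)
    (hp : LipschitzWith Λp ηp) (hψ : ContDiff ℝ 1 ψ)
    (hψc : HasCompactSupport ψ) {ε : ℝ} (hε : 0 < ε)
    (hthick : ∀ x ∈ tsupport ψ, 4 * ε ≤ ηp x.1 - ηm x.1)
    (hu : LocallyLipschitzOn (stripDomain ηm ηp) u)
    (hui : LocallyIntegrable u (volume.restrict (stripDomain ηm ηp)))
    (hdu : LocallyIntegrable (fderiv ℝ u) (volume.restrict (stripDomain ηm ηp)))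
    (v : Horiz n × ℝ) :
    ∫ x in stripDomain ηm ηp,
        stripCutoff ηm ηp ε x * (fderiv ℝ ψ x v * u x + ψ x * fderiv ℝ u x v) =
      ε⁻¹ * (∫ x in graphDepth (-1) ηp ⁻¹' Ioo ε (2 * ε), ψ x * u x * graphFlux ηp v x.1) -
      ε⁻¹ * ∫ x in graphDepth 1 ηm ⁻¹' Ioo ε (2 * ε), ψ x * u x * graphFlux ηm v x.1 := by
  have hΩ := (isOpen_stripDomain hm.continuous hp.continuous).measurableSet
  have hχ := @integrableOn_stripCutoff_mul n ηm ηp Λm Λp hm hp ε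
  obtain ⟨hint, hint'⟩ := integrable_mul_fderiv_add hψ hψc hui hdu v
  obtain ⟨hint_m, heq_m⟩ := integral_layer_indicator hm hψ.continuous hψc hui v
    fun x hx hl => eq_zero_of_graphDepth_mem_Ioo hthick hx (.inl hl)
  obtain ⟨hint_p, heq_p⟩ := integral_layer_indicator hp hψ.continuous hψc hui v
    fun x hx hl => eq_zero_of_graphDepth_mem_Ioo hthick hx (.inr hl)
  have hparts : ∫ x in stripDomain ηm ηp, (stripCutoff ηm ηp ε x * (fderiv ℝ ψ x v * u x) +
      ε⁻¹ * ((graphDepth 1 ηm ⁻¹' Ioo ε (2 * ε)).indicator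
        (fun x => ψ x * u x * graphFlux ηm v x.1) x -
      (graphDepth (-1) ηp ⁻¹' Ioo ε (2 * ε)).indicator
        (fun x => ψ x * u x * graphFlux ηp v x.1) x)) =
      -∫ x in stripDomain ηm ηp, stripCutoff ηm ηp ε x * (ψ x * fderiv ℝ u x v) := by
    simp only [← mul_assoc (stripCutoff ηm ηp ε _) (ψ _)]
    rw [← setIntegral_mul_fderiv_mul_stripCutoff hm hp hψ hψc hε hthick hu v]
    refine setIntegral_congr_ae hΩ ?_
    filter_upwards [ae_fderiv_mul_stripCutoff_apply hm hp hε (hψ.differentiable one_ne_zero) v]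
      with x hx _
    rw [hx]
    simp only [indicator]
    split_ifs <;> ring
  have hlayers := (hint_m.sub hint_p).const_mul ε⁻¹
  simp only [Pi.sub_apply] at hlayers
  rw [integral_add (hχ hint) hlayers, integral_const_mul, integral_sub hint_m hint_p, heq_m,
    heq_p] at hparts
  simp only [mul_add]
  rw [integral_add (hχ hint) (hχ hint')]
  linarith

theorem tendsto_setIntegral_stripCutoff_mul (hm : LipschitzWith Λm ηm)
    (hp : LipschitzWith Λp ηp) {g : Horiz n × ℝ → ℝ} (hg : IntegrableOn g (stripDomain ηm ηp)) :
    Tendsto (fun ε => ∫ x in stripDomain ηm ηp, stripCutoff ηm ηp ε x * g x) (𝓝[>] 0)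
      (𝓝 (∫ x in stripDomain ηm ηp, g x)) := by
  have hΩ := (isOpen_stripDomain hm.continuous hp.continuous).measurableSet
  refine tendsto_integral_filter_of_dominated_convergence (fun x => ‖g x‖)
    (Eventually.of_forall fun ε =>
      (integrableOn_stripCutoff_mul hm hp ε hg).aestronglyMeasurable)
    (Eventually.of_forall fun ε => ae_of_all _ fun x => ?_) hg.norm ?_
  · rw [norm_mul]
    exact mul_le_of_le_one_left (norm_nonneg _) (abs_stripCutoff_le_one ε x)
  · filter_upwards [ae_restrict_mem hΩ] with x hx
    simpa using (tendsto_stripCutoff hx).mul_const (g x)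

theorem exists_thickness_lower_bound (hm : Continuous ηm) (hp : Continuous ηp)
    (hlt : ∀ x, ηm x < ηp x) (hψc : HasCompactSupport ψ) :
    ∃ δ > 0, ∀ y ∈ Prod.fst '' tsupport ψ, δ ≤ ηp y - ηm y := by
  rcases (Prod.fst '' tsupport ψ).eq_empty_or_nonempty with h | h
  · exact ⟨1, one_pos, by simp [h]⟩
  · obtain ⟨y, -, hy⟩ := (isCompact_fst_image_tsupport hψc).exists_isMinOn h
      (hp.sub hm).continuousOn
    exact ⟨ηp y - ηm y, sub_pos.2 (hlt y), fun z hz => hy hz⟩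

theorem setIntegral_mul_fderiv_strip {fm fp : Horiz n → ℝ} (hm : LipschitzWith Λm ηm)
    (hp : LipschitzWith Λp ηp) (hlt : ∀ x, ηm x < ηp x) (hfm : LocallyIntegrable fm)
    (hfp : LocallyIntegrable fp) (hu : LocallyLipschitzOn (stripDomain ηm ηp) u)
    (hui : LocallyIntegrable u (volume.restrict (stripDomain ηm ηp)))
    (hdu : LocallyIntegrable (fderiv ℝ u) (volume.restrict (stripDomain ηm ηp)))
    (hum : LocallyIntegrable (fun x => (u x - fm x.1) / graphDepth 1 ηm x)
      (volume.restrict (stripDomain ηm ηp)))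
    (hup : LocallyIntegrable (fun x => (u x - fp x.1) / graphDepth (-1) ηp x)
      (volume.restrict (stripDomain ηm ηp)))
    (hψ : ContDiff ℝ 1 ψ) (hψc : HasCompactSupport ψ) (v : Horiz n × ℝ) :
    ∫ x in stripDomain ηm ηp, (fderiv ℝ ψ x v * u x + ψ x * fderiv ℝ u x v) =
      (∫ y, ψ (y, ηp y) * fp y * graphFlux ηp v y) -
        ∫ y, ψ (y, ηm y) * fm y * graphFlux ηm v y := by
  obtain ⟨δ, hδ, hthick⟩ := exists_thickness_lower_bound hm.continuous hp.continuous hlt hψc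
  have hstrip : ∀ x : Horiz n × ℝ, x.1 ∈ Prod.fst '' tsupport ψ →
      (graphDepth 1 ηm x ∈ Ioo 0 δ ∨ graphDepth (-1) ηp x ∈ Ioo 0 δ) →
      x ∈ stripDomain ηm ηp := fun x hx hl => by
    have hδx := hthick _ hx
    have hsum := graphDepth_add_graphDepth (ηm := ηm) (ηp := ηp) x
    rw [mem_stripDomain_iff]
    rcases hl with hl | hl <;> constructor <;> linarith [hl.1, hl.2]
  have hlim_m := tendsto_setIntegral_layer_trace hm abs_one hfm hψ hψc v hδ
    (fun x hx hl => hstrip x hx (.inl hl)) hum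
  have hlim_p := tendsto_setIntegral_layer_trace hp (by norm_num) hfp hψ hψc v hδ
    (fun x hx hl => hstrip x hx (.inr hl)) hup
  obtain ⟨hint, hint'⟩ := integrable_mul_fderiv_add hψ hψc hui hdu v
  refine tendsto_nhds_unique
    (tendsto_setIntegral_stripCutoff_mul hm hp (hint.add hint')) ((hlim_p.sub hlim_m).congr' ?_)
  filter_upwards [Ioo_mem_nhdsGT (show (0 : ℝ) < δ / 4 by positivity)] with ε hε
  exact (setIntegral_stripCutoff_mul hm hp hψ hψc hε.1 (fun x hx =>
    (by linarith [hε.2] : 4 * ε ≤ δ).trans (hthick _ (mem_image_of_mem _ hx))) hu hui hdu v).symm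

end Trace

section Gradient

variable {n : ℕ} {ηm ηp fm fp : Horiz n → ℝ} {u : Horiz n × ℝ → ℝ} {p : ℝ}

/-- The gradient of `u` with respect to the Euclidean inner product, as opposed to the
Fréchet derivative, whose norm is dual to the product norm of `ℝⁿ × ℝ`. -/
def euclGradient (u : Horiz n × ℝ → ℝ) (x : Horiz n × ℝ) : EVec n :=
  (InnerProductSpace.toDual ℝ (EVec n)).symm ((fderiv ℝ u x).comp
    (WithLp.prodContinuousLinearEquiv 2 ℝ (Horiz n) ℝ : EVec n →L[ℝ] Horiz n × ℝ))

theorem inner_euclGradient (u : Horiz n × ℝ → ℝ) (x v : Horiz n × ℝ) :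
    inner ℝ (WithLp.toLp 2 v) (euclGradient u x) = fderiv ℝ u x v := by
  rw [real_inner_comm, euclGradient, InnerProductSpace.toDual_symm_apply]
  rfl

theorem norm_euclGradient_le (u : Horiz n × ℝ → ℝ) (x : Horiz n × ℝ) :
    ‖euclGradient u x‖ ≤ ‖fderiv ℝ u x‖ := by
  rw [euclGradient, LinearIsometryEquiv.norm_map]
  refine ContinuousLinearMap.opNorm_le_bound _ (norm_nonneg _) fun w => ?_
  refine ((fderiv ℝ u x).le_opNorm _).trans (mul_le_mul_of_nonneg_left ?_ (norm_nonneg _))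
  exact max_le (WithLp.norm_fst_le _ w) (WithLp.norm_snd_le _ w)

theorem stronglyMeasurable_euclGradient (u : Horiz n × ℝ → ℝ) :
    StronglyMeasurable (euclGradient u) := by
  have hcont : Continuous fun A : Horiz n × ℝ →L[ℝ] ℝ =>
      (InnerProductSpace.toDual ℝ (EVec n)).symm (A.comp
        (WithLp.prodContinuousLinearEquiv 2 ℝ (Horiz n) ℝ : EVec n →L[ℝ] Horiz n × ℝ)) := by
    fun_prop
  exact hcont.comp_stronglyMeasurable (measurable_fderiv ℝ u).stronglyMeasurable

theorem MemLpLoc.locallyIntegrable (hp : 1 < p) {f : Horiz n → ℝ} (hf : MemLpLoc p f) :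
    LocallyIntegrable f := by
  refine locallyIntegrable_iff.2 fun K hK => ?_
  have : IsFiniteMeasure (volume.restrict K) := ⟨by simpa using hK.measure_lt_top⟩
  exact (hf K hK).integrable (by simpa using hp.le)

theorem HasTrace.isWeakGradient (hm : Continuous ηm) (hp : Continuous ηp)
    {G : Horiz n × ℝ → EVec n} (h : HasTrace p ηm ηp u G fm fp) :
    IsWeakGradient (stripDomain ηm ηp) u G := by
  obtain ⟨-, -, hu, hG, hparts⟩ := h
  have hΩ := (isOpen_stripDomain hm hp).isLocallyClosed
  refine ⟨(locallyIntegrableOn_iff hΩ).2 fun K hK hKc =>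
      (hu K hKc).mono_set (subset_inter hK le_rfl),
    (locallyIntegrableOn_iff hΩ).2 fun K hK hKc => (hG K hKc).mono_set (subset_inter hK le_rfl),
    fun φ hφ hc hs v => ?_⟩
  have hφ_off : ∀ x ∉ stripDomain ηm ηp, φ x = 0 := fun x hx =>
    image_eq_zero_of_notMem_tsupport fun h => hx (hs h)
  have hφ_p : ∀ y, φ (y, ηp y) = 0 := fun y => hφ_off _ fun h => lt_irrefl _ h.2
  have hφ_m : ∀ y, φ (y, ηm y) = 0 := fun y => hφ_off _ fun h => lt_irrefl _ h.1
  rw [hparts φ (hφ.of_le (by exact_mod_cast le_top)) hc v]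
  simp [hφ_p, hφ_m]

theorem locallyIntegrable_of_quotient (hm : Continuous ηm) (hp : Continuous ηp)
    (hfm : LocallyIntegrable fm)
    (hum : LocallyIntegrable (fun x => (u x - fm x.1) / graphDepth 1 ηm x)
      (volume.restrict (stripDomain ηm ηp))) :
    LocallyIntegrable u (volume.restrict (stripDomain ηm ηp)) := by
  have hΩ := (isOpen_stripDomain hm hp).measurableSet
  refine locallyIntegrable_iff.2 fun K hK => ?_
  have hprod := (hum.integrableOn_isCompact hK).mul_continuousOn
    (continuous_graphDepth (c := 1) hm).continuousOn hK
  have hf := Integrable.mono_measure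
    ((locallyIntegrable_comp_fst hfm).integrableOn_isCompact hK)
    (Measure.restrict_mono_measure (Measure.restrict_le_self (s := stripDomain ηm ηp)) K)
  refine (hprod.add hf).congr (ae_restrict_of_ae ?_)
  filter_upwards [ae_restrict_mem hΩ] with x hx
  have hτ : graphDepth 1 ηm x ≠ 0 := (mem_stripDomain_iff.1 hx).1.ne'
  simp [div_mul_cancel₀ _ hτ]

theorem hasTrace_euclGradient {Λm Λp : ℝ≥0} (hp : 1 < p) (hηm : LipschitzWith Λm ηm)
    (hηp : LipschitzWith Λp ηp) (hlt : ∀ x, ηm x < ηp x) (hfm : MemLpLoc p fm)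
    (hfp : MemLpLoc p fp) (hu : LocallyLipschitzOn (stripDomain ηm ηp) u)
    (hdu : LocallyIntegrable (fderiv ℝ u) (volume.restrict (stripDomain ηm ηp)))
    (hum : LocallyIntegrable (fun x => (u x - fm x.1) / graphDepth 1 ηm x)
      (volume.restrict (stripDomain ηm ηp)))
    (hup : LocallyIntegrable (fun x => (u x - fp x.1) / graphDepth (-1) ηp x)
      (volume.restrict (stripDomain ηm ηp))) :
    HasTrace p ηm ηp u (euclGradient u) fm fp := by
  have hui := locallyIntegrable_of_quotient hηm.continuous hηp.continuous
    (hfm.locallyIntegrable hp) hum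
  refine ⟨hfm, hfp, fun K hK => ?_, fun K hK => ?_, fun ψ hψ hψc v => ?_⟩
  · rw [inter_comm, IntegrableOn, ← Measure.restrict_restrict hK.measurableSet]
    exact hui.integrableOn_isCompact hK
  · rw [inter_comm, IntegrableOn, ← Measure.restrict_restrict hK.measurableSet]
    exact Integrable.mono (hdu.integrableOn_isCompact hK)
      (stronglyMeasurable_euclGradient u).aestronglyMeasurable
      (ae_of_all _ (norm_euclGradient_le u))
  · have hparts := setIntegral_mul_fderiv_strip hηm hηp hlt (hfm.locallyIntegrable hp)
      (hfp.locallyIntegrable hp) hu hui hdu hum hup hψ hψc v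
    obtain ⟨hint, hint'⟩ := integrable_mul_fderiv_add hψ hψc hui hdu v
    rw [integral_add hint hint'] at hparts
    simp only [graphFlux] at hparts
    simp only [inner_euclGradient, mul_comm (u _)]
    linarith

end Gradient

/-! ### Tent averages -/

theorem abs_inv_pow_succ_sub_inv_pow_succ_mul_le {r s t : ℝ} (hr : 0 < r)
    (hs : s ∈ Ioo (r / 2) (3 * r / 2)) (ht : t ∈ Ioo (r / 2) (3 * r / 2)) (d : ℕ) :
    |(s ^ (d + 1))⁻¹ - (t ^ (d + 1))⁻¹| * t ≤
      2 ^ (d + 1) * ((d + 1) * 3 ^ d) / r ^ (d + 1) * |s - t| := by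
  have hs0 : 0 < s := (half_pos hr).trans hs.1
  have ht0 : 0 < t := (half_pos hr).trans ht.1
  have hpow : |t ^ (d + 1) - s ^ (d + 1)| ≤ |s - t| * (d + 1) * (3 * r / 2) ^ d := by
    refine (abs_pow_sub_pow_le t s (d + 1)).trans ?_
    rw [abs_sub_comm, abs_of_pos hs0, abs_of_pos ht0, Nat.cast_succ, Nat.add_sub_cancel]
    gcongr
    exact max_le ht.2.le hs.2.le
  calc |(s ^ (d + 1))⁻¹ - (t ^ (d + 1))⁻¹| * t
      = |t ^ (d + 1) - s ^ (d + 1)| / (s ^ (d + 1) * t ^ d) := by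
        rw [inv_sub_inv (by positivity) (by positivity), abs_div,
          abs_of_pos (a := s ^ (d + 1) * t ^ (d + 1)) (by positivity)]
        field_simp
        ring
    _ ≤ |s - t| * (d + 1) * (3 * r / 2) ^ d / ((r / 2) ^ (d + 1) * (r / 2) ^ d) := by
        gcongr
        exacts [hs.1.le, ht.1.le]
    _ = 2 ^ (d + 1) * ((d + 1) * 3 ^ d) / r ^ (d + 1) * |s - t| := by
        simp only [div_pow, mul_pow]
        field_simp

theorem abs_tent_sub_tent_le {E : Type*} [SeminormedAddCommGroup E] (z₁ z₂ : E × ℝ) (w : E) :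
    |max (z₁.2 - ‖w - z₁.1‖) 0 - max (z₂.2 - ‖w - z₂.1‖) 0| ≤ 2 * ‖z₁ - z₂‖ := by
  have h₁ := abs_norm_sub_norm_le (w - z₂.1) (w - z₁.1)
  rw [sub_sub_sub_cancel_left] at h₁
  have h₂ := norm_fst_le (z₁ - z₂)
  have h₃ := norm_snd_le (z₁ - z₂)
  calc _ ≤ |(z₁.2 - ‖w - z₁.1‖) - (z₂.2 - ‖w - z₂.1‖)| := abs_max_sub_max_le_abs _ _ _
    _ = |(z₁.2 - z₂.2) + (‖w - z₂.1‖ - ‖w - z₁.1‖)| := by ring_nf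
    _ ≤ ‖z₁ - z₂‖ + ‖z₁ - z₂‖ := (abs_add_le _ _).trans (add_le_add h₃ (h₁.trans h₂))
    _ = 2 * ‖z₁ - z₂‖ := (two_mul _).symm

theorem snd_mem_Ioo_of_mem_ball {E : Type*} [SeminormedAddCommGroup E] {z z' : E × ℝ}
    (h : z' ∈ Metric.ball z (z.2 / 2)) :
    z'.2 ∈ Ioo (z.2 / 2) (3 * z.2 / 2) := by
  have hsnd := abs_lt.1 ((norm_snd_le (z' - z)).trans_lt (mem_ball_iff_norm.1 h))
  rw [Prod.snd_sub] at hsnd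
  constructor <;> linarith [hsnd.1, hsnd.2]

section Tent

open Module (finrank)

variable {E : Type*} [NormedAddCommGroup E] [NormedSpace ℝ E] [MeasurableSpace E]
  (μ : Measure E)

/-- The integral of the tent of height and radius `1`. -/
def tentMass : ℝ := ∫ w, max (1 - ‖w‖) 0 ∂μ

/-- The tent of radius `z.2` centred at `z.1`, normalized to have integral `1`. -/
def tentKernel (z : E × ℝ) (w : E) : ℝ :=
  max (z.2 - ‖w - z.1‖) 0 / (tentMass μ * z.2 ^ (finrank ℝ E + 1))

/-- The mean of `f` against the normalized tent of radius `z.2` centred at `z.1`: a mollification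
of `f` at the scale `z.2`, viewed as a function on the half-space `E × (0, ∞)`. -/
def tentAvg (f : E → ℝ) (z : E × ℝ) : ℝ := ∫ w, f w * tentKernel μ z w ∂μ

/-- The Lipschitz constant of the normalized tent as a function of its centre and radius, near
radius `1`. -/
def tentLipConst : ℝ :=
  2 ^ (finrank ℝ E + 1) * (2 + (finrank ℝ E + 1) * 3 ^ finrank ℝ E) / tentMass μ

/-- The oscillation of `f` about `f z.1` on the ball of radius `2 * z.2`, divided by the power of
`z.2` that makes it bound the gradient of the tent average. -/
def oscQuot (f : E → ℝ) (z : E × ℝ) : ℝ :=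
  (∫ w in Metric.ball z.1 (2 * z.2), |f w - f z.1| ∂μ) / z.2 ^ (finrank ℝ E + 1)

theorem oscQuot_nonneg (f : E → ℝ) {z : E × ℝ} (hz : 0 < z.2) : 0 ≤ oscQuot μ f z :=
  div_nonneg (integral_nonneg fun _ => abs_nonneg _) (pow_nonneg hz.le _)

theorem continuous_tentKernel (z : E × ℝ) : Continuous (tentKernel μ z) := by
  unfold tentKernel; fun_prop

theorem tentKernel_eq_zero {z : E × ℝ} {w : E} (hw : z.2 ≤ dist w z.1) :
    tentKernel μ z w = 0 := by
  rw [tentKernel, max_eq_right (by rw [← dist_eq_norm]; linarith), zero_div]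

variable {μ} {f g : E → ℝ}

theorem tentAvg_smul (c : ℝ) (f : E → ℝ) (z : E × ℝ) :
    tentAvg μ (c • f) z = c * tentAvg μ f z := by
  simp only [tentAvg, Pi.smul_apply, smul_eq_mul, mul_assoc, integral_const_mul]

variable [FiniteDimensional ℝ E]

theorem hasCompactSupport_tentKernel (z : E × ℝ) :
    HasCompactSupport (tentKernel μ z) :=
  have := FiniteDimensional.proper_real E
  HasCompactSupport.intro (isCompact_closedBall z.1 z.2) fun w hw =>
    tentKernel_eq_zero μ (by simpa using (not_le.1 hw).le)

theorem abs_integral_mul_le_oscQuot [IsLocallyFiniteMeasure μ] (hf : LocallyIntegrable f μ)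
    {z : E × ℝ} {k : E → ℝ} {C : ℝ} (hk : ∀ w, |k w| ≤ C / z.2 ^ (finrank ℝ E + 1))
    (hk_zero : ∀ w, 2 * z.2 ≤ dist w z.1 → k w = 0) :
    |∫ w, (f w - f z.1) * k w ∂μ| ≤ C * oscQuot μ f z := by
  have := FiniteDimensional.proper_real E
  have hosc : IntegrableOn (fun w => |f w - f z.1|) (Metric.ball z.1 (2 * z.2)) μ :=
    (((hf.sub (locallyIntegrable_const (f z.1))).integrableOn_isCompact
      (isCompact_closedBall z.1 (2 * z.2))).mono_set Metric.ball_subset_closedBall).abs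
  calc |∫ w, (f w - f z.1) * k w ∂μ|
      = |∫ w in Metric.ball z.1 (2 * z.2), (f w - f z.1) * k w ∂μ| := by
        rw [setIntegral_eq_integral_of_forall_compl_eq_zero fun w hw => ?_]
        rw [hk_zero w (not_lt.1 hw), mul_zero]
    _ ≤ ∫ w in Metric.ball z.1 (2 * z.2), |f w - f z.1| * (C / z.2 ^ (finrank ℝ E + 1)) ∂μ :=
        norm_integral_le_of_norm_le (f := fun w => (f w - f z.1) * k w) (hosc.mul_const _)
          (ae_of_all _ fun w => by
            rw [norm_mul]; exact mul_le_mul_of_nonneg_left (hk w) (norm_nonneg _))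
    _ = C * oscQuot μ f z := by rw [integral_mul_const, oscQuot]; ring

theorem integrable_mul_tentKernel [OpensMeasurableSpace E] (hf : LocallyIntegrable f μ)
    (z : E × ℝ) : Integrable (fun w => f w * tentKernel μ z w) μ := by
  simpa only [smul_eq_mul, mul_comm] using hf.integrable_smul_left_of_hasCompactSupport
    (continuous_tentKernel μ z) (hasCompactSupport_tentKernel z)

theorem tentAvg_add [OpensMeasurableSpace E] (hf : LocallyIntegrable f μ)
    (hg : LocallyIntegrable g μ) (z : E × ℝ) :
    tentAvg μ (f + g) z = tentAvg μ f z + tentAvg μ g z := by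
  simp only [tentAvg, Pi.add_apply, add_mul]
  exact integral_add (integrable_mul_tentKernel hf z) (integrable_mul_tentKernel hg z)

variable (μ) [BorelSpace E] [μ.IsAddHaarMeasure]

theorem tentMass_pos : 0 < tentMass μ := by
  have := FiniteDimensional.proper_real E
  refine Continuous.integral_pos_of_hasCompactSupport_nonneg_nonzero (x := 0) (by fun_prop)
    (HasCompactSupport.intro (isCompact_closedBall (0 : E) 1) fun w hw => ?_)
    (fun w => le_max_right _ _) (by simp)
  exact max_eq_right (by simpa using (not_le.1 (mt mem_closedBall_zero_iff.2 hw)).le)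

theorem integral_tentKernel {z : E × ℝ} (hz : 0 < z.2) : ∫ w, tentKernel μ z w ∂μ = 1 := by
  have hscale : ∀ w : E, max (z.2 - ‖w‖) 0 = z.2 * max (1 - ‖z.2⁻¹ • w‖) 0 := fun w => by
    rw [mul_max_of_nonneg _ _ hz.le, norm_smul, norm_inv, Real.norm_of_nonneg hz.le, mul_zero,
      mul_sub, mul_one, mul_inv_cancel_left₀ hz.ne']
  have htent : ∫ w, max (z.2 - ‖w - z.1‖) 0 ∂μ = tentMass μ * z.2 ^ (finrank ℝ E + 1) := by
    rw [integral_sub_right_eq_self (fun w => max (z.2 - ‖w‖) 0) z.1]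
    simp only [hscale]
    rw [integral_const_mul,
      Measure.integral_comp_inv_smul_of_nonneg μ (fun w => max (1 - ‖w‖) 0) hz.le, tentMass,
      smul_eq_mul]
    ring
  simp only [tentKernel]
  rw [integral_div, htent, div_self]
  exact (mul_pos (tentMass_pos μ) (pow_pos hz _)).ne'

variable {μ}

theorem tentAvg_sub_const (hf : LocallyIntegrable f μ) (b : ℝ) {z : E × ℝ} (hz : 0 < z.2) :
    tentAvg μ f z - b = ∫ w, (f w - b) * tentKernel μ z w ∂μ := by
  have hker : Integrable (tentKernel μ z) μ :=
    (continuous_tentKernel μ z).integrable_of_hasCompactSupport (hasCompactSupport_tentKernel z)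
  simp only [sub_mul]
  rw [integral_sub (integrable_mul_tentKernel hf z) (hker.const_mul b), integral_const_mul,
    integral_tentKernel μ hz, mul_one, tentAvg]

theorem abs_tentAvg_sub_le (hf : LocallyIntegrable f μ) {z : E × ℝ} (hz : 0 < z.2) :
    |tentAvg μ f z - f z.1| ≤ z.2 / tentMass μ * oscQuot μ f z := by
  have := FiniteDimensional.proper_real E
  have hm := tentMass_pos μ
  rw [tentAvg_sub_const hf _ hz]
  refine abs_integral_mul_le_oscQuot hf (fun w => ?_)
    fun w hw => tentKernel_eq_zero μ (by linarith)
  rw [tentKernel, abs_div, abs_of_nonneg (le_max_right _ _), abs_of_pos (by positivity), ← div_div]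
  gcongr
  exact max_le (by linarith [norm_nonneg (w - z.1)]) hz.le

theorem abs_tentKernel_sub_le {z z₁ z₂ : E × ℝ} (hz : 0 < z.2)
    (h₁ : z₁ ∈ Metric.ball z (z.2 / 2)) (h₂ : z₂ ∈ Metric.ball z (z.2 / 2)) (w : E) :
    |tentKernel μ z₁ w - tentKernel μ z₂ w| ≤
      tentLipConst μ * ‖z₁ - z₂‖ / z.2 ^ (finrank ℝ E + 1) := by
  have hm := tentMass_pos μ
  have hs := snd_mem_Ioo_of_mem_ball h₁
  have ht := snd_mem_Ioo_of_mem_ball h₂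
  have ht0 : 0 < z₂.2 := (half_pos hz).trans ht.1
  have hs0 : 0 < z₁.2 := (half_pos hz).trans hs.1
  have hsplit : tentKernel μ z₁ w - tentKernel μ z₂ w = (tentMass μ)⁻¹ *
      ((max (z₁.2 - ‖w - z₁.1‖) 0 - max (z₂.2 - ‖w - z₂.1‖) 0) / z₁.2 ^ (finrank ℝ E + 1) +
        ((z₁.2 ^ (finrank ℝ E + 1))⁻¹ - (z₂.2 ^ (finrank ℝ E + 1))⁻¹) *
          max (z₂.2 - ‖w - z₂.1‖) 0) := by
    simp only [tentKernel]
    field_simp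
    ring
  have hnum : |(max (z₁.2 - ‖w - z₁.1‖) 0 - max (z₂.2 - ‖w - z₂.1‖) 0) /
      z₁.2 ^ (finrank ℝ E + 1)| ≤ 2 * ‖z₁ - z₂‖ / (z.2 / 2) ^ (finrank ℝ E + 1) := by
    rw [abs_div, abs_of_pos (pow_pos hs0 _)]
    gcongr
    exacts [abs_tent_sub_tent_le z₁ z₂ w, hs.1.le]
  have hden : |((z₁.2 ^ (finrank ℝ E + 1))⁻¹ - (z₂.2 ^ (finrank ℝ E + 1))⁻¹) *
      max (z₂.2 - ‖w - z₂.1‖) 0| ≤ 2 ^ (finrank ℝ E + 1) *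
        ((finrank ℝ E + 1) * 3 ^ finrank ℝ E) / z.2 ^ (finrank ℝ E + 1) * ‖z₁ - z₂‖ := by
    rw [abs_mul, abs_of_nonneg (le_max_right (z₂.2 - ‖w - z₂.1‖) 0)]
    refine (mul_le_mul_of_nonneg_left (max_le (sub_le_self _ (norm_nonneg _)) ht0.le)
      (abs_nonneg _)).trans ((abs_inv_pow_succ_sub_inv_pow_succ_mul_le hz hs ht _).trans ?_)
    gcongr
    exact norm_snd_le (z₁ - z₂)
  rw [hsplit, abs_mul, abs_of_pos (inv_pos.2 hm)]
  refine (mul_le_mul_of_nonneg_left ((abs_add_le _ _).trans (add_le_add hnum hden))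
    (inv_pos.2 hm).le).trans_eq ?_
  rw [tentLipConst, div_pow]
  field_simp

theorem lipschitzOnWith_tentAvg (hf : LocallyIntegrable f μ) {z : E × ℝ} (hz : 0 < z.2) :
    LipschitzOnWith (Real.toNNReal (tentLipConst μ * oscQuot μ f z))
      (tentAvg μ f) (Metric.ball z (z.2 / 2)) := by
  refine LipschitzOnWith.of_dist_le_mul fun z₁ h₁ z₂ h₂ => ?_
  have := FiniteDimensional.proper_real E
  have hfb := hf.sub (locallyIntegrable_const (f z.1))
  have hsub : tentAvg μ f z₁ - tentAvg μ f z₂ =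
      ∫ w, (f w - f z.1) * (tentKernel μ z₁ w - tentKernel μ z₂ w) ∂μ := by
    rw [← sub_sub_sub_cancel_right _ _ (f z.1),
      tentAvg_sub_const hf _ ((half_pos hz).trans (snd_mem_Ioo_of_mem_ball h₁).1),
      tentAvg_sub_const hf _ ((half_pos hz).trans (snd_mem_Ioo_of_mem_ball h₂).1)]
    simp only [mul_sub]
    exact (integral_sub (integrable_mul_tentKernel hfb z₁) (integrable_mul_tentKernel hfb z₂)).symm
  have hfar : ∀ z' ∈ Metric.ball z (z.2 / 2), ∀ w, 2 * z.2 ≤ dist w z.1 →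
      tentKernel μ z' w = 0 := fun z' hz' w hw => tentKernel_eq_zero μ <| by
    have hfst := (norm_fst_le (z' - z)).trans_lt (mem_ball_iff_norm.1 hz')
    rw [Prod.fst_sub, ← dist_eq_norm] at hfst
    linarith [dist_triangle w z'.1 z.1, (snd_mem_Ioo_of_mem_ball hz').2]
  have hosc := abs_integral_mul_le_oscQuot hf (abs_tentKernel_sub_le (μ := μ) hz h₁ h₂)
    fun w hw => by rw [hfar z₁ h₁ w hw, hfar z₂ h₂ w hw, sub_zero]
  rw [Real.dist_eq, dist_eq_norm, hsub]
  refine (hosc.trans_eq (by ring)).trans (mul_le_mul_of_nonneg_right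
    (Real.le_coe_toNNReal _) (norm_nonneg _))

end Tent

/-! ### Energy of the oscillation quotient -/

theorem lintegral_enorm_rpow_le {α : Type*} [MeasurableSpace α] {μ : Measure α} {p : ℝ}
    (hp : 1 ≤ p) {g : α → ℝ} (hg : AEStronglyMeasurable g μ) :
    (∫⁻ x, ‖g x‖ₑ ∂μ) ^ p ≤ μ univ ^ (p - 1) * ∫⁻ x, ‖g x‖ₑ ^ p ∂μ := by
  have hp0 : 0 < p := zero_lt_one.trans_le hp
  have h := eLpNorm'_le_eLpNorm'_mul_rpow_measure_univ zero_lt_one hp hg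
  rw [eLpNorm'_eq_lintegral_enorm, eLpNorm'_eq_lintegral_enorm] at h
  simp only [ENNReal.rpow_one, div_one] at h
  refine (ENNReal.rpow_le_rpow h hp0.le).trans_eq ?_
  rw [ENNReal.mul_rpow_of_nonneg _ _ hp0.le, ← ENNReal.rpow_mul, ← ENNReal.rpow_mul,
    one_div_mul_cancel hp0.ne', ENNReal.rpow_one, sub_mul, one_mul, one_div_mul_cancel hp0.ne',
    mul_comm]

theorem lintegral_Ioi_ofReal_rpow_neg {q c : ℝ} (hq : 1 < q) (hc : 0 < c) :
    ∫⁻ t in Ioi c, ENNReal.ofReal (t ^ (-q)) = ENNReal.ofReal (c ^ (1 - q) / (q - 1)) := by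
  rw [← ofReal_integral_eq_lintegral_ofReal (integrableOn_Ioi_rpow_of_lt (by linarith) hc),
    integral_Ioi_rpow_of_lt (by linarith) hc, ← neg_sub q 1, neg_add_eq_sub, ← neg_sub q 1,
    neg_div_neg_eq]
  filter_upwards [ae_restrict_mem measurableSet_Ioi] with t ht
  exact Real.rpow_nonneg (hc.trans ht).le _

section Oscillation

open Module (finrank)

variable {E : Type*} [NormedAddCommGroup E]

theorem setLIntegral_rpow_neg_of_norm_lt_le {q : ℝ} (hq : 1 < q) {h : E} (hh : h ≠ 0) (R : ℝ)
    (b : ℝ≥0∞) :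
    ∫⁻ t in Ioo 0 R, {t : ℝ | ‖h‖ < 2 * t}.indicator (fun t => ENNReal.ofReal (t ^ (-q)) * b) t ≤
      (Metric.ball (0 : E) (2 * R)).indicator
        (fun h => ENNReal.ofReal (2 ^ (q - 1) / (q - 1)) * (b / ‖h‖ₑ ^ (q - 1))) h := by
  have hpos : 0 < ‖h‖ := norm_pos_iff.2 hh
  by_cases hb : h ∈ Metric.ball (0 : E) (2 * R)
  · have hS : {t : ℝ | ‖h‖ < 2 * t} = Ioi (‖h‖ / 2) := by
      ext t; rw [mem_ofPred_eq, mem_Ioi, div_lt_iff₀' (by norm_num)]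
    rw [hS, indicator_of_mem hb]
    refine (setLIntegral_le_lintegral _ _).trans_eq ?_
    rw [lintegral_indicator measurableSet_Ioi, lintegral_mul_const _ (by fun_prop),
      lintegral_Ioi_ofReal_rpow_neg hq (half_pos hpos), ← neg_sub q 1,
      Real.rpow_neg (half_pos hpos).le, Real.div_rpow hpos.le two_pos.le, inv_div,
      div_right_comm, ENNReal.ofReal_div_of_pos (by positivity),
      ← ENNReal.ofReal_rpow_of_pos hpos, ofReal_norm]
    simp only [div_eq_mul_inv, mul_assoc, mul_comm b]
  · rw [indicator_of_notMem hb]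
    refine (setLIntegral_eq_zero measurableSet_Ioo fun t ht => indicator_of_notMem ?_ _).le
    rw [mem_ball_zero_iff, not_lt] at hb
    rw [mem_ofPred_eq, not_lt]
    linarith [ht.2]

variable [MeasurableSpace E] [BorelSpace E]

theorem setLIntegral_rpow_neg_mul_ball_le [SecondCountableTopology E] {μ : Measure E} [SFinite μ]
    {q : ℝ} (hq : 1 < q) {g : E → ℝ≥0∞} (hg : AEMeasurable g μ) (hg₀ : g 0 = 0) (R : ℝ) :
    ∫⁻ t in Ioo 0 R, ENNReal.ofReal (t ^ (-q)) * ∫⁻ h in Metric.ball 0 (2 * t), g h ∂μ ≤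
      ENNReal.ofReal (2 ^ (q - 1) / (q - 1)) *
        ∫⁻ h in Metric.ball 0 (2 * R), g h / ‖h‖ₑ ^ (q - 1) ∂μ := by
  have hS : MeasurableSet {x : ℝ × E | ‖x.2‖ < 2 * x.1} :=
    (isOpen_lt (by fun_prop) (by fun_prop)).measurableSet
  have hrpow : Measurable fun t : ℝ => ENNReal.ofReal (t ^ (-q)) := by fun_prop
  calc ∫⁻ t in Ioo 0 R, ENNReal.ofReal (t ^ (-q)) * ∫⁻ h in Metric.ball 0 (2 * t), g h ∂μ
      = ∫⁻ t in Ioo 0 R, ∫⁻ h, {x : ℝ × E | ‖x.2‖ < 2 * x.1}.indicator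
          (fun x => ENNReal.ofReal (x.1 ^ (-q)) * g x.2) (t, h) ∂μ := by
        refine lintegral_congr fun t => ?_
        rw [← lintegral_const_mul' _ _ ENNReal.ofReal_ne_top,
          ← lintegral_indicator Metric.isOpen_ball.measurableSet]
        simp only [indicator, mem_ball_zero_iff, mem_ofPred_eq]
    _ = ∫⁻ h, (∫⁻ t in Ioo 0 R, {x : ℝ × E | ‖x.2‖ < 2 * x.1}.indicator
          (fun x => ENNReal.ofReal (x.1 ^ (-q)) * g x.2) (t, h)) ∂μ :=
        lintegral_lintegral_swap
          (((hrpow.comp measurable_fst).aemeasurable.mul hg.comp_snd).indicator hS)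
    _ ≤ ∫⁻ h, (Metric.ball 0 (2 * R)).indicator (fun h =>
          ENNReal.ofReal (2 ^ (q - 1) / (q - 1)) * (g h / ‖h‖ₑ ^ (q - 1))) h ∂μ := by
        refine lintegral_mono fun h => ?_
        rcases eq_or_ne h 0 with rfl | hh
        · simp [indicator, hg₀]
        · exact setLIntegral_rpow_neg_of_norm_lt_le hq hh R (g h)
    _ = _ := by
        rw [lintegral_indicator Metric.isOpen_ball.measurableSet,
          lintegral_const_mul' _ _ ENNReal.ofReal_ne_top]

variable [NormedSpace ℝ E] [FiniteDimensional ℝ E] (μ : Measure E) [μ.IsAddHaarMeasure]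
  {f : E → ℝ}

theorem aemeasurable_oscQuot (hf : AEStronglyMeasurable f μ) :
    AEMeasurable (oscQuot μ f) (μ.prod volume) := by
  have hS : MeasurableSet {x : (E × ℝ) × E | dist x.2 x.1.1 < 2 * x.1.2} :=
    (isOpen_lt (by fun_prop) (by fun_prop)).measurableSet
  have hint : AEStronglyMeasurable ({x : (E × ℝ) × E | dist x.2 x.1.1 < 2 * x.1.2}.indicator
      fun x => |f x.2 - f x.1.1|) ((μ.prod volume).prod μ) :=
    (hf.comp_snd.sub hf.comp_fst.comp_fst).norm.indicator hS
  refine AEMeasurable.div (hint.integral_prod_right'.aemeasurable.congr (ae_of_all _ fun z => ?_))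
    (by fun_prop)
  exact integral_indicator (f := fun w => |f w - f z.1|)
    (Metric.isOpen_ball (x := z.1) (ε := 2 * z.2)).measurableSet

/-- The constant in the pointwise Hölder estimate of the oscillation quotient. -/
def oscHolderConst (p : ℝ) : ℝ := (2 ^ finrank ℝ E * μ.real (Metric.ball 0 1)) ^ (p - 1)

theorem ofReal_oscQuot_eq_lintegral (hf : LocallyIntegrable f μ) (y : E) {r : ℝ} (hr : 0 < r) :
    ENNReal.ofReal (oscQuot μ f (y, r)) = (∫⁻ h in Metric.ball 0 (2 * r), ‖f (y + h) - f y‖ₑ ∂μ) /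
      ENNReal.ofReal (r ^ (finrank ℝ E + 1)) := by
  have := FiniteDimensional.proper_real E
  have hi : IntegrableOn (fun w => f w - f y) (Metric.ball y (2 * r)) μ :=
    ((hf.sub (locallyIntegrable_const (f y))).integrableOn_isCompact
      (isCompact_closedBall y (2 * r))).mono_set Metric.ball_subset_closedBall
  rw [oscQuot, ENNReal.ofReal_div_of_pos (by positivity)]
  congr 1
  refine (ofReal_integral_norm_eq_lintegral_enorm hi).trans ?_
  rw [← lintegral_indicator Metric.isOpen_ball.measurableSet,
    ← lintegral_indicator Metric.isOpen_ball.measurableSet, ← lintegral_add_left_eq_self _ y]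
  simp only [indicator, Metric.mem_ball, dist_self_add_left, dist_zero_right]

theorem ofReal_oscQuot_rpow_le {p : ℝ} (hp : 1 ≤ p) (hf : LocallyIntegrable f μ) (y : E) {r : ℝ}
    (hr : 0 < r) :
    ENNReal.ofReal (oscQuot μ f (y, r)) ^ p ≤
      ENNReal.ofReal (oscHolderConst μ p) * (ENNReal.ofReal (r ^ (-(p + finrank ℝ E))) *
        ∫⁻ h in Metric.ball 0 (2 * r), ‖f (y + h) - f y‖ₑ ^ p ∂μ) := by
  have hp0 : 0 < p := zero_lt_one.trans_le hp
  have hincr : AEStronglyMeasurable (fun h => f (y + h) - f y) μ :=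
    (hf.aestronglyMeasurable.comp_quasiMeasurePreserving
      (measurePreserving_add_left μ y).quasiMeasurePreserving).sub aestronglyMeasurable_const
  have hvol : μ (Metric.ball 0 (2 * r)) =
      ENNReal.ofReal (r ^ finrank ℝ E * (2 ^ finrank ℝ E * μ.real (Metric.ball 0 1))) := by
    rw [Measure.addHaar_ball_of_pos _ _ (by positivity), mul_pow, mul_comm (2 ^ _), ← mul_assoc,
      ENNReal.ofReal_mul (p := r ^ _ * 2 ^ _) (by positivity),
      ofReal_measureReal Metric.isBounded_ball.measure_lt_top.ne]
  have hpow : (r ^ finrank ℝ E * (2 ^ finrank ℝ E * μ.real (Metric.ball 0 1))) ^ (p - 1) /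
      (r ^ (finrank ℝ E + 1)) ^ p = oscHolderConst μ p * r ^ (-(p + finrank ℝ E)) := by
    rw [Real.mul_rpow (by positivity) (by positivity), oscHolderConst,
      ← Real.rpow_natCast r, ← Real.rpow_natCast r, ← Real.rpow_mul hr.le, ← Real.rpow_mul hr.le,
      mul_comm, mul_div_assoc, ← Real.rpow_sub hr]
    congr 2
    push_cast
    ring
  rw [ofReal_oscQuot_eq_lintegral μ hf y hr, ENNReal.div_rpow_of_nonneg _ _ hp0.le]
  refine (ENNReal.div_le_div_right (lintegral_enorm_rpow_le hp hincr.restrict) _).trans_eq ?_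
  rw [Measure.restrict_apply_univ, hvol, ENNReal.ofReal_rpow_of_nonneg (by positivity)
    (sub_nonneg.2 hp), ENNReal.ofReal_rpow_of_pos (by positivity),
    ← mul_assoc (ENNReal.ofReal (oscHolderConst μ p)),
    ← ENNReal.ofReal_mul (by unfold oscHolderConst; positivity), ← hpow, ENNReal.ofReal_div_of_pos
    (by positivity), ENNReal.mul_div_right_comm]

/-- The constant in the energy estimate of the oscillation quotient. -/
def oscEnergyConst (p : ℝ) : ℝ :=
  oscHolderConst μ p * (2 ^ (p + finrank ℝ E - 1) / (p + finrank ℝ E - 1))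

theorem setLIntegral_oscQuot_rpow_le {p : ℝ} (hp : 1 < p) (hf : LocallyIntegrable f μ) (y : E)
    (R : ℝ) :
    ∫⁻ t in Ioo 0 R, ENNReal.ofReal (oscQuot μ f (y, t)) ^ p ≤
      ENNReal.ofReal (oscEnergyConst μ p) * ∫⁻ h in Metric.ball 0 (2 * R),
        ‖f (y + h) - f y‖ₑ ^ p / ‖h‖ₑ ^ (p + finrank ℝ E - 1) ∂μ := by
  have hincr : AEMeasurable (fun h => ‖f (y + h) - f y‖ₑ ^ p) μ :=
    ((hf.aestronglyMeasurable.comp_quasiMeasurePreserving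
      (measurePreserving_add_left μ y).quasiMeasurePreserving).sub
        aestronglyMeasurable_const).enorm.pow_const p
  have hq : 1 < p + finrank ℝ E := lt_add_of_lt_of_nonneg hp (Nat.cast_nonneg _)
  refine (setLIntegral_mono' measurableSet_Ioo fun t ht =>
    ofReal_oscQuot_rpow_le μ hp.le hf y ht.1).trans ?_
  rw [lintegral_const_mul' _ _ ENNReal.ofReal_ne_top, oscEnergyConst,
    ENNReal.ofReal_mul (by unfold oscHolderConst; positivity), mul_assoc]
  gcongr
  exact setLIntegral_rpow_neg_mul_ball_le hq hincr (by simp [zero_lt_one.trans hp]) R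

end Oscillation

section StripEnergy

theorem setLIntegral_graphDepth {α : Type*} [MeasurableSpace α] {μ : Measure α} [SFinite μ]
    {η R : α → ℝ} (hη : Measurable η) (hR : Measurable R) {c : ℝ} (hc : c ≠ 0)
    {F : α × ℝ → ℝ≥0∞} (hF : AEMeasurable F (μ.prod volume)) :
    ∫⁻ x in {x | graphDepth c η x ∈ Ioo 0 (R x.1)}, F (x.1, graphDepth c η x) ∂μ.prod volume =
      ENNReal.ofReal |c⁻¹| * ∫⁻ y, (∫⁻ t in Ioo 0 (R y), F (y, t)) ∂μ := by
  have hS : MeasurableSet {z : α × ℝ | z.2 ∈ Ioo 0 (R z.1)} :=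
    (measurableSet_lt measurable_const measurable_snd).inter
      (measurableSet_lt measurable_snd (hR.comp measurable_fst))
  have hT := measurePreserving_graphDepth (μ := μ) hη hc
  have hFS := hF.indicator hS
  calc ∫⁻ x in {x | graphDepth c η x ∈ Ioo 0 (R x.1)}, F (x.1, graphDepth c η x) ∂μ.prod volume
      = ∫⁻ x, {z : α × ℝ | z.2 ∈ Ioo 0 (R z.1)}.indicator F (x.1, graphDepth c η x)
          ∂μ.prod volume := by
        exact (lintegral_indicator (hT.measurable hS) _).symm
    _ = ENNReal.ofReal |c⁻¹| * ∫⁻ z, {z : α × ℝ | z.2 ∈ Ioo 0 (R z.1)}.indicator F z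
          ∂μ.prod volume := by
        rw [Measure.prod_smul_right] at hT
        rw [← lintegral_map' _ hT.aemeasurable, hT.map_eq, lintegral_smul_measure, smul_eq_mul]
        rw [hT.map_eq]
        exact hFS.smul_measure _
    _ = ENNReal.ofReal |c⁻¹| * ∫⁻ y, (∫⁻ t in Ioo 0 (R y), F (y, t)) ∂μ := by
        rw [lintegral_prod _ hFS]
        simp only [← lintegral_indicator measurableSet_Ioo]
        rfl

variable {n : ℕ} {ηm ηp : Horiz n → ℝ} {a p : ℝ} {f fm fp : Horiz n → ℝ}

theorem stripDomain_eq_lower {c : ℝ} (hc : 0 < c) :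
    stripDomain ηm ηp = {x | graphDepth c ηm x ∈ Ioo 0 (c * (ηp x.1 - ηm x.1))} := by
  ext x
  simp [stripDomain, graphDepth, hc]

theorem stripDomain_eq_upper {c : ℝ} (hc : 0 < c) :
    stripDomain ηm ηp = {x | graphDepth (-c) ηp x ∈ Ioo 0 (c * (ηp x.1 - ηm x.1))} := by
  ext x
  have hdepth : graphDepth (-c) ηp x = c * (ηp x.1 - x.2) := by rw [graphDepth]; ring
  rw [mem_ofPred_eq, hdepth, mem_Ioo, mul_pos_iff_of_pos_left hc, mul_lt_mul_iff_right₀ hc,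
    sub_pos, sub_lt_sub_iff_left, and_comm]
  rfl

theorem lintegral_oscQuot_rpow_le (hp : 1 < p) (hf : LocallyIntegrable f) :
    ∫⁻ y, ∫⁻ t in Ioo 0 (a / 2 * (ηp y - ηm y)), ENNReal.ofReal (oscQuot volume f (y, t)) ^ p ≤
      ENNReal.ofReal (oscEnergyConst (volume : Measure (Horiz n)) p) *
        screenedEnergy (1 - 1 / p) p (stripScreen a ηm ηp) f := by
  rw [screenedEnergy, ← lintegral_const_mul' _ _ ENNReal.ofReal_ne_top]
  refine lintegral_mono fun y => (setLIntegral_oscQuot_rpow_le volume hp hf y _).trans_eq ?_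
  have hexp : (1 - 1 / p) * p + n = p + n - 1 := by field_simp; ring
  rw [hexp, finrank_euclideanSpace_fin, stripScreen, ← mul_assoc, mul_div_cancel₀ _ two_ne_zero]

theorem setLIntegral_oscQuot_graphDepth_le {η : Horiz n → ℝ} (hη : Continuous η)
    (hm : Continuous ηm) (hq : Continuous ηp) {c : ℝ} (ha : 0 < a) (hc : |c| = a / 2)
    (hstrip : stripDomain ηm ηp = {x | graphDepth c η x ∈ Ioo 0 (a / 2 * (ηp x.1 - ηm x.1))})
    (hp : 1 < p) (hf : LocallyIntegrable f) :
    ∫⁻ x in stripDomain ηm ηp, ENNReal.ofReal (oscQuot volume f (x.1, graphDepth c η x)) ^ p ≤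
      ENNReal.ofReal (2 / a * oscEnergyConst (volume : Measure (Horiz n)) p) *
        screenedEnergy (1 - 1 / p) p (stripScreen a ηm ηp) f := by
  have hc0 : c ≠ 0 := abs_pos.1 (hc ▸ half_pos ha)
  have hR : Measurable fun y => a / 2 * (ηp y - ηm y) := by fun_prop
  rw [hstrip, Measure.volume_eq_prod, setLIntegral_graphDepth hη.measurable hR hc0
    (F := fun z => ENNReal.ofReal (oscQuot volume f z) ^ p)
    ((aemeasurable_oscQuot volume hf.aestronglyMeasurable).ennreal_ofReal.pow_const p),
    abs_inv, hc, inv_div, ENNReal.ofReal_mul (by positivity), mul_assoc]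
  gcongr
  exact lintegral_oscQuot_rpow_le hp hf

theorem setLIntegral_diffQuot (hm : Continuous ηm) (hq : Continuous ηp) (hlt : ∀ y, ηm y < ηp y)
    (hp : 1 < p) (hfm : AEMeasurable fm) (hfp : AEMeasurable fp) :
    ∫⁻ x in stripDomain ηm ηp, ENNReal.ofReal (|fp x.1 - fm x.1| / (ηp x.1 - ηm x.1)) ^ p =
      weightedDiff p ηm ηp fm fp := by
  have hR : Measurable fun y => 1 * (ηp y - ηm y) := by fun_prop
  have hquot : AEMeasurable fun y => |fp y - fm y| / (ηp y - ηm y) :=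
    (hfp.sub hfm).norm.div (hq.sub hm).measurable.aemeasurable
  rw [stripDomain_eq_lower one_pos, Measure.volume_eq_prod, setLIntegral_graphDepth hm.measurable hR
    one_ne_zero (F := fun z => ENNReal.ofReal (|fp z.1 - fm z.1| / (ηp z.1 - ηm z.1)) ^ p)
    (hquot.ennreal_ofReal.pow_const p).comp_fst, weightedDiff]
  simp only [inv_one, abs_one, ENNReal.ofReal_one, one_mul, setLIntegral_const, Real.volume_Ioo,
    sub_zero]
  refine lintegral_congr fun y => ?_
  have hd : 0 < ηp y - ηm y := sub_pos.2 (hlt y)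
  rw [← ofReal_norm, Real.norm_eq_abs, ENNReal.ofReal_rpow_of_nonneg (by positivity) (by linarith),
    ENNReal.ofReal_rpow_of_nonneg (by positivity) (by linarith),
    ← ENNReal.ofReal_mul (by positivity), ← ENNReal.ofReal_div_of_pos (by positivity),
    Real.div_rpow (by positivity) hd.le, Real.rpow_sub_one hd.ne']
  field_simp

end StripEnergy

/-! ### The extension -/

/-- The weighted mean of `A` and `B` that equals `A` for `s = 0` and `B` for `t = 0`. -/
def blend (s t A B : ℝ) : ℝ := (t * A + s * B) / (s + t)

section Blend

theorem blend_comm (s t A B : ℝ) : blend s t A B = blend t s B A := by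
  rw [blend, blend, add_comm (t * A), add_comm s]

theorem abs_blend_sub_blend_le {s t s' t' : ℝ} (hs : 0 < s) (ht : 0 < t) (hs' : 0 < s')
    (ht' : 0 < t') (A B A' B' : ℝ) :
    |blend s t A B - blend s' t' A' B'| ≤
      |A - A'| + |B - B'| + (|s - s'| + |t - t'|) * (|B' - A'| / (s' + t')) := by
  have hweight : |s / (s + t)| ≤ 1 ∧ |t / (s + t)| ≤ 1 := by
    simp only [abs_div, abs_of_pos hs, abs_of_pos ht, abs_of_pos (add_pos hs ht)]
    exact ⟨div_le_one_of_le₀ (by linarith) (by linarith),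
      div_le_one_of_le₀ (by linarith) (by linarith)⟩
  have hsplit : blend s t A B - blend s' t' A' B' =
      t / (s + t) * (A - A') + s / (s + t) * (B - B') +
        (t / (s + t) * (s - s') - s / (s + t) * (t - t')) * ((B' - A') / (s' + t')) := by
    unfold blend
    field_simp
    ring
  have hmul : ∀ w r : ℝ, |w| ≤ 1 → |w * r| ≤ |r| := fun w r hw => by
    rw [abs_mul]
    exact mul_le_of_le_one_left (abs_nonneg r) hw
  rw [hsplit, ← abs_of_pos (add_pos hs' ht'), ← abs_div, abs_of_pos (add_pos hs' ht')]
  refine (abs_add_le _ _).trans (add_le_add ((abs_add_le _ _).trans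
    (add_le_add (hmul _ _ hweight.2) (hmul _ _ hweight.1))) ?_)
  rw [abs_mul]
  gcongr
  exact (abs_sub _ _).trans (add_le_add (hmul _ _ hweight.2) (hmul _ _ hweight.1))

theorem abs_blend_sub_div_le {s t A B b K K' : ℝ} (hs : 0 < s) (ht : 0 < t)
    (hA : |A - b| ≤ s * K) (hBA : |B - A| ≤ (s + t) * K') :
    |(blend s t A B - b) / s| ≤ K + K' := by
  have hsplit : blend s t A B - b = (A - b) + s / (s + t) * (B - A) := by
    unfold blend
    field_simp
    ring
  rw [abs_div, abs_of_pos hs, div_le_iff₀ hs, hsplit]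
  calc |(A - b) + s / (s + t) * (B - A)|
      ≤ |A - b| + s / (s + t) * |B - A| := by
        refine (abs_add_le _ _).trans_eq ?_
        rw [abs_mul, abs_of_pos (div_pos hs (add_pos hs ht))]
    _ ≤ s * K + s / (s + t) * ((s + t) * K') := by gcongr
    _ = (K + K') * s := by field_simp

theorem locallyLipschitzOn_blend {X : Type*} [PseudoMetricSpace X] {Ω : Set X} {s t A B : X → ℝ}
    {Ks Kt : ℝ≥0} (hs : LipschitzWith Ks s) (ht : LipschitzWith Kt t) (hs0 : ∀ x ∈ Ω, 0 < s x)
    (ht0 : ∀ x ∈ Ω, 0 < t x) (hA : LocallyLipschitzOn Ω A) (hB : LocallyLipschitzOn Ω B) :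
    LocallyLipschitzOn Ω fun x => blend (s x) (t x) (A x) (B x) := by
  intro x hx
  obtain ⟨KA, U, hU, hKA⟩ := hA hx
  obtain ⟨KB, V, hV, hKB⟩ := hB hx
  have hslope : ContinuousWithinAt (fun y => |B y - A y| / (s y + t y)) Ω x :=
    ((hB.continuousOn x hx).sub (hA.continuousOn x hx)).abs.div
      (hs.continuous.add ht.continuous).continuousWithinAt (add_pos (hs0 x hx) (ht0 x hx)).ne'
  set C : ℝ≥0 := Real.toNNReal (|B x - A x| / (s x + t x) + 1)
  have hC : ∀ᶠ y in 𝓝[Ω] x, |B y - A y| / (s y + t y) ≤ C :=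
    (hslope.eventually_lt_const (lt_add_one _)).mono fun y hy =>
      hy.le.trans (Real.le_coe_toNNReal _)
  refine ⟨KA + KB + (Ks + Kt) * C, U ∩ V ∩ {y | |B y - A y| / (s y + t y) ≤ C} ∩ Ω,
    inter_mem (inter_mem (inter_mem hU hV) hC) self_mem_nhdsWithin,
    LipschitzOnWith.of_dist_le_mul ?_⟩
  rintro y ⟨⟨⟨hyU, hyV⟩, -⟩, hy⟩ z ⟨⟨⟨hzU, hzV⟩, hzC : _ ≤ (C : ℝ)⟩, hz⟩
  have hsz := hs0 z hz
  have htz := ht0 z hz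
  calc _ ≤ dist (A y) (A z) + dist (B y) (B z) +
        (dist (s y) (s z) + dist (t y) (t z)) * (|B z - A z| / (s z + t z)) :=
      abs_blend_sub_blend_le (hs0 y hy) (ht0 y hy) hsz htz _ _ _ _
    _ ≤ KA * dist y z + KB * dist y z + (Ks * dist y z + Kt * dist y z) * C := by
      gcongr
      exacts [hKA.dist_le_mul y hyU z hzU, hKB.dist_le_mul y hyV z hzV, hs.dist_le_mul y z,
        ht.dist_le_mul y z]
    _ = _ := by push_cast; ring

theorem norm_fderiv_blend_le {E : Type*} [NormedAddCommGroup E] [NormedSpace ℝ E] {x : E}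
    {s t A B : E → ℝ} {Ks Kt KA KB : ℝ≥0} (hs : LipschitzWith Ks s) (ht : LipschitzWith Kt t)
    (hs0 : 0 < s x) (ht0 : 0 < t x) (hA : ∃ U ∈ 𝓝 x, LipschitzOnWith KA A U)
    (hB : ∃ U ∈ 𝓝 x, LipschitzOnWith KB B U) :
    ‖fderiv ℝ (fun y => blend (s y) (t y) (A y) (B y)) x‖ ≤
      KA + KB + (Ks + Kt) * (|B x - A x| / (s x + t x)) := by
  obtain ⟨U, hU, hKA⟩ := hA
  obtain ⟨V, hV, hKB⟩ := hB
  refine norm_fderiv_le_of_lip' ℝ (by positivity) ?_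
  filter_upwards [hU, hV, hs.continuous.continuousAt.eventually_const_lt hs0,
    ht.continuous.continuousAt.eventually_const_lt ht0] with y hyU hyV hsy hty
  calc _ ≤ ‖A y - A x‖ + ‖B y - B x‖ +
        (‖s y - s x‖ + ‖t y - t x‖) * (|B x - A x| / (s x + t x)) :=
      abs_blend_sub_blend_le hsy hty hs0 ht0 _ _ _ _
    _ ≤ KA * ‖y - x‖ + KB * ‖y - x‖ +
        (Ks * ‖y - x‖ + Kt * ‖y - x‖) * (|B x - A x| / (s x + t x)) := by
      gcongr
      exacts [hKA.norm_sub_le hyU (mem_of_mem_nhds hU), hKB.norm_sub_le hyV (mem_of_mem_nhds hV),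
        hs.norm_sub_le y x, ht.norm_sub_le y x]
    _ = _ := by ring

end Blend

theorem exists_lipschitzOnWith_tentAvg_graphDepth {E : Type*} [NormedAddCommGroup E]
    [NormedSpace ℝ E] [FiniteDimensional ℝ E] [MeasurableSpace E] [BorelSpace E] {μ : Measure E}
    [μ.IsAddHaarMeasure] {f η : E → ℝ} {Λ : ℝ≥0} {c : ℝ} (hf : LocallyIntegrable f μ)
    (hη : LipschitzWith Λ η) {x : E × ℝ} (hx : 0 < graphDepth c η x) :
    ∃ U ∈ 𝓝 x, LipschitzOnWith
      (Real.toNNReal (tentLipConst μ * oscQuot μ f (x.1, graphDepth c η x)) *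
        ((1 + ‖c‖₊) * (1 + Λ))) (fun y => tentAvg μ f (y.1, graphDepth c η y)) U := by
  have hdepth : LipschitzWith ((1 + ‖c‖₊) * (1 + Λ)) fun y : E × ℝ => (y.1, graphDepth c η y) := by
    refine (LipschitzWith.prod_fst.prodMk (lipschitzWith_graphDepth hη)).weaken (max_le ?_ ?_)
    · exact one_le_mul_of_one_le_of_one_le le_self_add le_self_add
    · exact mul_le_mul_left le_add_self _
  exact ⟨_, hdepth.continuous.continuousAt.preimage_mem_nhds
    (Metric.ball_mem_nhds _ (half_pos hx)),
    (lipschitzOnWith_tentAvg hf hx).comp hdepth.lipschitzOnWith (mapsTo_preimage _ _)⟩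

section Extension

variable {n : ℕ} {a : ℝ} {ηm ηp fm fp : Horiz n → ℝ} {Λm Λp : ℝ≥0} {x : Horiz n × ℝ}

/-- The extension of a pair of boundary functions to the strip: each function is averaged over
tents whose radius is `a / 2` times the depth of the point relative to the corresponding graph, and
the two averages are interpolated linearly along the vertical segments. -/
def stripExt (a : ℝ) (ηm ηp : Horiz n → ℝ) (f : (Horiz n → ℝ) × (Horiz n → ℝ))
    (x : Horiz n × ℝ) : ℝ :=
  blend (graphDepth 1 ηm x) (graphDepth (-1) ηp x)
    (tentAvg volume f.1 (x.1, graphDepth (a / 2) ηm x))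
    (tentAvg volume f.2 (x.1, graphDepth (-(a / 2)) ηp x))

/-- The function that dominates, up to a constant, the gradient of the extension and its difference
quotients towards the two graphs. -/
def stripMajorant (a : ℝ) (ηm ηp fm fp : Horiz n → ℝ) (x : Horiz n × ℝ) : ℝ :=
  |fp x.1 - fm x.1| / (ηp x.1 - ηm x.1) + oscQuot volume fm (x.1, graphDepth (a / 2) ηm x) +
    oscQuot volume fp (x.1, graphDepth (-(a / 2)) ηp x)

theorem graphDepth_mul {E : Type*} (c d : ℝ) (η : E → ℝ) (x : E × ℝ) :
    graphDepth (c * d) η x = c * graphDepth d η x := mul_assoc _ _ _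

theorem stripExt_add {f g : (Horiz n → ℝ) × (Horiz n → ℝ)}
    (hf₁ : LocallyIntegrable f.1) (hf₂ : LocallyIntegrable f.2) (hg₁ : LocallyIntegrable g.1)
    (hg₂ : LocallyIntegrable g.2) :
    stripExt a ηm ηp (f + g) = stripExt a ηm ηp f + stripExt a ηm ηp g := by
  funext x
  simp only [stripExt, blend, Prod.fst_add, Prod.snd_add, tentAvg_add hf₁ hg₁,
    tentAvg_add hf₂ hg₂, Pi.add_apply]
  ring

theorem stripExt_smul (c : ℝ) (f : (Horiz n → ℝ) × (Horiz n → ℝ)) :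
    stripExt a ηm ηp (c • f) = c • stripExt a ηm ηp f := by
  funext x
  simp only [stripExt, blend, Prod.smul_fst, Prod.smul_snd, tentAvg_smul, Pi.smul_apply,
    smul_eq_mul]
  ring

theorem graphDepth_half_pos (ha : 0 < a) (hx : x ∈ stripDomain ηm ηp) :
    0 < graphDepth (a / 2) ηm x ∧ 0 < graphDepth (-(a / 2)) ηp x := by
  rw [mem_stripDomain_iff] at hx
  rw [← mul_one (a / 2), ← mul_neg, graphDepth_mul, graphDepth_mul]
  exact ⟨mul_pos (half_pos ha) hx.1, mul_pos (half_pos ha) hx.2⟩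

theorem locallyLipschitzOn_stripExt (ha : 0 < a) (hm : LipschitzWith Λm ηm)
    (hp : LipschitzWith Λp ηp) (hfm : LocallyIntegrable fm) (hfp : LocallyIntegrable fp) :
    LocallyLipschitzOn (stripDomain ηm ηp) (stripExt a ηm ηp (fm, fp)) := by
  refine locallyLipschitzOn_blend (lipschitzWith_graphDepth hm) (lipschitzWith_graphDepth hp)
    (fun x hx => (mem_stripDomain_iff.1 hx).1) (fun x hx => (mem_stripDomain_iff.1 hx).2)
    (fun x hx => ?_) (fun x hx => ?_)
  · obtain ⟨U, hU, hK⟩ := exists_lipschitzOnWith_tentAvg_graphDepth hfm hm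
      (graphDepth_half_pos ha hx).1
    exact ⟨_, U, mem_nhdsWithin_of_mem_nhds hU, hK⟩
  · obtain ⟨U, hU, hK⟩ := exists_lipschitzOnWith_tentAvg_graphDepth hfp hp
      (graphDepth_half_pos ha hx).2
    exact ⟨_, U, mem_nhdsWithin_of_mem_nhds hU, hK⟩

theorem oscQuot_lower_nonneg (ha : 0 < a) (hx : x ∈ stripDomain ηm ηp) (f : Horiz n → ℝ) :
    0 ≤ oscQuot volume f (x.1, graphDepth (a / 2) ηm x) :=
  oscQuot_nonneg volume f (graphDepth_half_pos ha hx).1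

theorem oscQuot_upper_nonneg (ha : 0 < a) (hx : x ∈ stripDomain ηm ηp) (f : Horiz n → ℝ) :
    0 ≤ oscQuot volume f (x.1, graphDepth (-(a / 2)) ηp x) :=
  oscQuot_nonneg volume f (graphDepth_half_pos ha hx).2

theorem diffQuot_nonneg (hx : x ∈ stripDomain ηm ηp) (fm fp : Horiz n → ℝ) :
    0 ≤ |fp x.1 - fm x.1| / (ηp x.1 - ηm x.1) :=
  div_nonneg (abs_nonneg _) (sub_nonneg.2 (hx.1.trans hx.2).le)

theorem stripMajorant_nonneg (ha : 0 < a) (hx : x ∈ stripDomain ηm ηp) :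
    0 ≤ stripMajorant a ηm ηp fm fp x :=
  add_nonneg (add_nonneg (diffQuot_nonneg hx fm fp) (oscQuot_lower_nonneg ha hx fm))
    (oscQuot_upper_nonneg ha hx fp)

theorem abs_tentAvg_lower_sub_le (ha : 0 < a) (hfm : LocallyIntegrable fm)
    (hx : x ∈ stripDomain ηm ηp) :
    |tentAvg volume fm (x.1, graphDepth (a / 2) ηm x) - fm x.1| ≤ graphDepth 1 ηm x *
      (a / 2 / tentMass (volume : Measure (Horiz n)) * stripMajorant a ηm ηp fm fp x) := by
  have hmass := tentMass_pos (volume : Measure (Horiz n))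
  have hscale := graphDepth_mul (a / 2) 1 ηm x
  rw [mul_one] at hscale
  calc _ ≤ graphDepth (a / 2) ηm x / tentMass volume *
        oscQuot volume fm (x.1, graphDepth (a / 2) ηm x) :=
      abs_tentAvg_sub_le hfm (graphDepth_half_pos ha hx).1
    _ ≤ graphDepth (a / 2) ηm x / tentMass volume * stripMajorant a ηm ηp fm fp x := by
      have := (graphDepth_half_pos ha hx).1
      gcongr
      unfold stripMajorant
      linarith [diffQuot_nonneg hx fm fp, oscQuot_upper_nonneg ha hx fp]
    _ = _ := by rw [hscale]; ring

theorem abs_tentAvg_upper_sub_le (ha : 0 < a) (hfp : LocallyIntegrable fp)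
    (hx : x ∈ stripDomain ηm ηp) :
    |tentAvg volume fp (x.1, graphDepth (-(a / 2)) ηp x) - fp x.1| ≤ graphDepth (-1) ηp x *
      (a / 2 / tentMass (volume : Measure (Horiz n)) * stripMajorant a ηm ηp fm fp x) := by
  have hmass := tentMass_pos (volume : Measure (Horiz n))
  have hscale := graphDepth_mul (a / 2) (-1) ηp x
  rw [mul_neg_one] at hscale
  calc _ ≤ graphDepth (-(a / 2)) ηp x / tentMass volume *
        oscQuot volume fp (x.1, graphDepth (-(a / 2)) ηp x) :=
      abs_tentAvg_sub_le hfp (graphDepth_half_pos ha hx).2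
    _ ≤ graphDepth (-(a / 2)) ηp x / tentMass volume * stripMajorant a ηm ηp fm fp x := by
      have := (graphDepth_half_pos ha hx).2
      gcongr
      unfold stripMajorant
      linarith [diffQuot_nonneg hx fm fp, oscQuot_lower_nonneg ha hx fm]
    _ = _ := by rw [hscale]; ring

theorem abs_tentAvg_upper_sub_lower_le (ha : 0 < a) (hfm : LocallyIntegrable fm)
    (hfp : LocallyIntegrable fp) (hx : x ∈ stripDomain ηm ηp) :
    |tentAvg volume fp (x.1, graphDepth (-(a / 2)) ηp x) -
        tentAvg volume fm (x.1, graphDepth (a / 2) ηm x)| ≤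
      (graphDepth 1 ηm x + graphDepth (-1) ηp x) *
        ((1 + a / 2 / tentMass (volume : Measure (Horiz n))) *
          stripMajorant a ηm ηp fm fp x) := by
  have hthick : 0 < ηp x.1 - ηm x.1 := sub_pos.2 (hx.1.trans hx.2)
  have hlower := abs_tentAvg_lower_sub_le (fp := fp) ha hfm hx
  have hupper := abs_tentAvg_upper_sub_le (fm := fm) ha hfp hx
  have hdiff : |fp x.1 - fm x.1| ≤ (graphDepth 1 ηm x + graphDepth (-1) ηp x) *
      stripMajorant a ηm ηp fm fp x := by
    rw [graphDepth_add_graphDepth, ← div_le_iff₀' hthick, stripMajorant]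
    linarith [oscQuot_lower_nonneg ha hx fm, oscQuot_upper_nonneg ha hx fp]
  rw [abs_sub_comm] at hlower
  refine ((abs_sub_le _ (fp x.1) _).trans (add_le_add hupper ((abs_sub_le _ (fm x.1) _).trans
    (add_le_add hdiff hlower)))).trans_eq ?_
  ring

/-- The constant in the pointwise estimates of the extension by its majorant. -/
def extPointConst (n : ℕ) (a : ℝ) : ℝ :=
  tentLipConst (volume : Measure (Horiz n)) * (1 + a / 2) +
    2 * (1 + a / 2 / tentMass (volume : Measure (Horiz n)))

theorem tentLipConst_pos (n : ℕ) : 0 < tentLipConst (volume : Measure (Horiz n)) := by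
  have := tentMass_pos (volume : Measure (Horiz n))
  unfold tentLipConst; positivity

theorem extPointConst_pos (n : ℕ) (ha : 0 < a) : 0 < extPointConst n a := by
  have := tentMass_pos (volume : Measure (Horiz n))
  have := tentLipConst_pos n
  unfold extPointConst; positivity

theorem boundaryConst_le_extPointConst (n : ℕ) (ha : 0 < a) :
    a / 2 / tentMass (volume : Measure (Horiz n)) +
      (1 + a / 2 / tentMass (volume : Measure (Horiz n))) ≤ extPointConst n a := by
  have := tentLipConst_pos n
  have : 0 ≤ tentLipConst (volume : Measure (Horiz n)) * (1 + a / 2) := by positivity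
  unfold extPointConst
  linarith

theorem abs_stripExt_sub_lower_le (ha : 0 < a) (hfm : LocallyIntegrable fm)
    (hfp : LocallyIntegrable fp) (hx : x ∈ stripDomain ηm ηp) :
    |(stripExt a ηm ηp (fm, fp) x - fm x.1) / graphDepth 1 ηm x| ≤
      extPointConst n a * stripMajorant a ηm ηp fm fp x := by
  obtain ⟨hs, ht⟩ := mem_stripDomain_iff.1 hx
  refine (abs_blend_sub_div_le hs ht (abs_tentAvg_lower_sub_le (fp := fp) ha hfm hx)
    (abs_tentAvg_upper_sub_lower_le ha hfm hfp hx)).trans ?_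
  rw [← add_mul]
  exact mul_le_mul_of_nonneg_right (boundaryConst_le_extPointConst n ha)
    (stripMajorant_nonneg ha hx)

theorem abs_stripExt_sub_upper_le (ha : 0 < a) (hfm : LocallyIntegrable fm)
    (hfp : LocallyIntegrable fp) (hx : x ∈ stripDomain ηm ηp) :
    |(stripExt a ηm ηp (fm, fp) x - fp x.1) / graphDepth (-1) ηp x| ≤
      extPointConst n a * stripMajorant a ηm ηp fm fp x := by
  obtain ⟨hs, ht⟩ := mem_stripDomain_iff.1 hx
  have hdiff := abs_tentAvg_upper_sub_lower_le ha hfm hfp hx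
  rw [abs_sub_comm, add_comm (graphDepth 1 ηm x)] at hdiff
  rw [stripExt, blend_comm]
  refine (abs_blend_sub_div_le ht hs (abs_tentAvg_upper_sub_le (fm := fm) ha hfp hx)
    hdiff).trans ?_
  rw [← add_mul]
  exact mul_le_mul_of_nonneg_right (boundaryConst_le_extPointConst n ha)
    (stripMajorant_nonneg ha hx)

theorem oscQuot_add_oscQuot_le_stripMajorant (hx : x ∈ stripDomain ηm ηp) (fm fp : Horiz n → ℝ) :
    oscQuot volume fm (x.1, graphDepth (a / 2) ηm x) +
        oscQuot volume fp (x.1, graphDepth (-(a / 2)) ηp x) ≤ stripMajorant a ηm ηp fm fp x := by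
  rw [stripMajorant]
  linarith [diffQuot_nonneg hx fm fp]

theorem norm_fderiv_stripExt_le (ha : 0 < a) (hm : LipschitzWith Λm ηm)
    (hp : LipschitzWith Λp ηp) (hfm : LocallyIntegrable fm) (hfp : LocallyIntegrable fp)
    (hx : x ∈ stripDomain ηm ηp) :
    ‖fderiv ℝ (stripExt a ηm ηp (fm, fp)) x‖ ≤
      extPointConst n a * (1 + (Λm + Λp)) * stripMajorant a ηm ηp fm fp x := by
  obtain ⟨hs, ht⟩ := mem_stripDomain_iff.1 hx
  have hlip := (tentLipConst_pos n).le
  have hosc_m := mul_nonneg hlip (oscQuot_lower_nonneg ha hx fm)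
  have hosc_p := mul_nonneg hlip (oscQuot_upper_nonneg ha hx fp)
  have hosc := mul_le_mul_of_nonneg_left
    (oscQuot_add_oscQuot_le_stripMajorant (a := a) hx fm fp) hlip
  have hslope := (div_le_iff₀' (add_pos hs ht)).2 (abs_tentAvg_upper_sub_lower_le ha hfm hfp hx)
  have hnorm : ‖a / 2‖ = a / 2 := Real.norm_of_nonneg (half_pos ha).le
  refine (norm_fderiv_blend_le (lipschitzWith_graphDepth hm) (lipschitzWith_graphDepth hp) hs ht
    (exists_lipschitzOnWith_tentAvg_graphDepth hfm hm (graphDepth_half_pos ha hx).1)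
    (exists_lipschitzOnWith_tentAvg_graphDepth hfp hp (graphDepth_half_pos ha hx).2)).trans ?_
  simp only [NNReal.coe_mul, NNReal.coe_add, NNReal.coe_one, Real.coe_toNNReal _ hosc_m,
    Real.coe_toNNReal _ hosc_p, coe_nnnorm, norm_neg, norm_one, one_mul, hnorm]
  rw [mul_add] at hosc
  set K := tentLipConst (volume : Measure (Horiz n))
  set om := K * oscQuot volume fm (x.1, graphDepth (a / 2) ηm x)
  set op := K * oscQuot volume fp (x.1, graphDepth (-(a / 2)) ηp x)
  set Q := stripMajorant a ηm ηp fm fp x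
  set k := 1 + a / 2 / tentMass (volume : Measure (Horiz n))
  calc _ ≤ om * ((1 + a / 2) * (1 + (Λm + Λp))) + op * ((1 + a / 2) * (1 + (Λm + Λp))) +
          (1 + (Λm + Λp) + (1 + (Λm + Λp))) * (k * Q) := by
        gcongr <;> linarith [Λm.coe_nonneg, Λp.coe_nonneg]
    _ = (om + op) * ((1 + a / 2) * (1 + (Λm + Λp))) + 2 * (1 + (Λm + Λp)) * (k * Q) := by ring
    _ ≤ K * Q * ((1 + a / 2) * (1 + (Λm + Λp))) + 2 * (1 + (Λm + Λp)) * (k * Q) := by gcongr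
    _ = extPointConst n a * (1 + (Λm + Λp)) * Q := by rw [extPointConst]; ring

end Extension

section Assembly

variable {n : ℕ} {a p : ℝ} {ηm ηp fm fp : Horiz n → ℝ} {Λm Λp : ℝ≥0}

/-- The quantity that controls the energy of the extension: the weighted difference of the boundary
functions and their two screened energies. -/
def boundaryEnergy (a p : ℝ) (ηm ηp fm fp : Horiz n → ℝ) : ℝ≥0∞ :=
  weightedDiff p ηm ηp fm fp + screenedEnergy (1 - 1 / p) p (stripScreen a ηm ηp) fm +
    screenedEnergy (1 - 1 / p) p (stripScreen a ηm ηp) fp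

theorem aemeasurable_oscQuot_graphDepth {η f : Horiz n → ℝ} {c : ℝ} (hη : Continuous η)
    (hc : c ≠ 0) (hf : LocallyIntegrable f) :
    AEMeasurable fun x : Horiz n × ℝ => oscQuot volume f (x.1, graphDepth c η x) := by
  have hqmp := (measurePreserving_graphDepth (μ := volume) hη.measurable hc).quasiMeasurePreserving
  rw [Measure.prod_smul_right] at hqmp
  exact ((aemeasurable_oscQuot volume hf.aestronglyMeasurable).smul_measure _)
    |>.comp_quasiMeasurePreserving hqmp

theorem aemeasurable_stripMajorant (ha : 0 < a) (hm : Continuous ηm) (hq : Continuous ηp)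
    (hfm : LocallyIntegrable fm) (hfp : LocallyIntegrable fp) :
    AEMeasurable (stripMajorant a ηm ηp fm fp) := by
  have hdiff : AEMeasurable fun y => |fp y - fm y| / (ηp y - ηm y) :=
    (hfp.aestronglyMeasurable.aemeasurable.sub hfm.aestronglyMeasurable.aemeasurable).norm.div
      (hq.sub hm).measurable.aemeasurable
  have ha2 := (half_pos ha).ne'
  exact (hdiff.comp_fst.add (aemeasurable_oscQuot_graphDepth hm ha2 hfm)).add
    (aemeasurable_oscQuot_graphDepth hq (neg_ne_zero.2 ha2) hfp)

theorem add_add_rpow_le (hp : 1 ≤ p) (x y z : ℝ≥0∞) :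
    (x + y + z) ^ p ≤ 3 ^ (p - 1) * (x ^ p + y ^ p + z ^ p) := by
  simpa [Fin.sum_univ_three] using
    ENNReal.rpow_sum_le_const_mul_sum_rpow Finset.univ ![x, y, z] hp

theorem add_mul_add_mul_le (k x y z : ℝ≥0∞) : x + k * y + k * z ≤ (1 + k) * (x + y + z) := by
  rw [mul_add, mul_add]
  gcongr
  · exact le_mul_of_one_le_left zero_le le_self_add
  · exact le_add_self
  · exact le_add_self

/-- The constant in the `L^p` estimate of the majorant. -/
def majorantConst (n : ℕ) (a p : ℝ) : ℝ≥0 :=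
  3 ^ (p - 1) * (1 + (2 / a * oscEnergyConst (volume : Measure (Horiz n)) p).toNNReal)

theorem lintegral_stripMajorant_rpow_le (ha : 0 < a) (hp : 1 < p) (hm : Continuous ηm)
    (hq : Continuous ηp) (hlt : ∀ y, ηm y < ηp y) (hfm : LocallyIntegrable fm)
    (hfp : LocallyIntegrable fp) :
    ∫⁻ x in stripDomain ηm ηp, ENNReal.ofReal (stripMajorant a ηm ηp fm fp x) ^ p ≤
      majorantConst n a p * boundaryEnergy a p ηm ηp fm fp := by
  have ha2 := half_pos ha
  have hmeas_m := (aemeasurable_oscQuot_graphDepth hm ha2.ne' hfm).ennreal_ofReal.pow_const p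
  have hmeas_p := (aemeasurable_oscQuot_graphDepth hq (neg_ne_zero.2 ha2.ne')
    hfp).ennreal_ofReal.pow_const p
  have hosc_m := setLIntegral_oscQuot_graphDepth_le hm hm hq ha (abs_of_pos ha2)
    (stripDomain_eq_lower ha2) hp hfm
  have hosc_p := setLIntegral_oscQuot_graphDepth_le hq hm hq ha
    ((abs_neg _).trans (abs_of_pos ha2)) (stripDomain_eq_upper ha2) hp hfp
  calc ∫⁻ x in stripDomain ηm ηp, ENNReal.ofReal (stripMajorant a ηm ηp fm fp x) ^ p
      ≤ ∫⁻ x in stripDomain ηm ηp, 3 ^ (p - 1) *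
          (ENNReal.ofReal (|fp x.1 - fm x.1| / (ηp x.1 - ηm x.1)) ^ p +
            ENNReal.ofReal (oscQuot volume fm (x.1, graphDepth (a / 2) ηm x)) ^ p +
            ENNReal.ofReal (oscQuot volume fp (x.1, graphDepth (-(a / 2)) ηp x)) ^ p) := by
        refine lintegral_mono fun x => le_trans ?_ (add_add_rpow_le hp.le _ _ _)
        gcongr
        exact ENNReal.ofReal_add_le.trans (add_le_add_left ENNReal.ofReal_add_le _)
    _ ≤ 3 ^ (p - 1) * (weightedDiff p ηm ηp fm fp +
          ENNReal.ofReal (2 / a * oscEnergyConst (volume : Measure (Horiz n)) p) *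
            screenedEnergy (1 - 1 / p) p (stripScreen a ηm ηp) fm +
          ENNReal.ofReal (2 / a * oscEnergyConst (volume : Measure (Horiz n)) p) *
            screenedEnergy (1 - 1 / p) p (stripScreen a ηm ηp) fp) := by
        rw [lintegral_const_mul' _ _ (by finiteness), lintegral_add_right' _ hmeas_p.restrict,
          lintegral_add_right' _ hmeas_m.restrict, setLIntegral_diffQuot hm hq hlt hp
            hfm.aestronglyMeasurable.aemeasurable hfp.aestronglyMeasurable.aemeasurable]
        gcongr
    _ ≤ majorantConst n a p * boundaryEnergy a p ηm ηp fm fp := by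
        rw [majorantConst, ENNReal.coe_mul, ENNReal.coe_rpow_of_nonneg _ (sub_nonneg.2 hp.le),
          mul_assoc]
        exact mul_le_mul_right (add_mul_add_mul_le _ _ _ _) _

theorem memLp_stripMajorant (ha : 0 < a) (hp : 1 < p) (hm : Continuous ηm) (hq : Continuous ηp)
    (hlt : ∀ y, ηm y < ηp y) (hfm : LocallyIntegrable fm) (hfp : LocallyIntegrable fp)
    (hfin : boundaryEnergy a p ηm ηp fm fp ≠ ⊤) :
    MemLp (stripMajorant a ηm ηp fm fp) (ENNReal.ofReal p)
      (volume.restrict (stripDomain ηm ηp)) := by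
  have hp0 : 0 < p := one_pos.trans hp
  refine ⟨(aemeasurable_stripMajorant ha hm hq hfm hfp).aestronglyMeasurable.restrict,
    (eLpNorm_lt_top_iff_lintegral_rpow_enorm_lt_top (by simpa using hp0)
      ENNReal.ofReal_ne_top).2 ?_⟩
  rw [ENNReal.toReal_ofReal hp0.le, setLIntegral_congr_fun
    (isOpen_stripDomain hm hq).measurableSet fun x hx => by
      rw [Real.enorm_eq_ofReal (stripMajorant_nonneg ha hx)]]
  exact (lintegral_stripMajorant_rpow_le ha hp hm hq hlt hfm hfp).trans_lt
    (ENNReal.mul_lt_top ENNReal.coe_lt_top hfin.lt_top)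

theorem norm_fderiv_stripExt_ae_le (ha : 0 < a) (hm : LipschitzWith Λm ηm)
    (hq : LipschitzWith Λp ηp) (hfm : LocallyIntegrable fm) (hfp : LocallyIntegrable fp) :
    ∀ᵐ x ∂volume.restrict (stripDomain ηm ηp), ‖fderiv ℝ (stripExt a ηm ηp (fm, fp)) x‖ ≤
      extPointConst n a * (1 + (Λm + Λp)) * ‖stripMajorant a ηm ηp fm fp x‖ := by
  filter_upwards [ae_restrict_mem (isOpen_stripDomain hm.continuous hq.continuous).measurableSet]
    with x hx
  rw [Real.norm_of_nonneg (stripMajorant_nonneg ha hx)]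
  exact norm_fderiv_stripExt_le ha hm hq hfm hfp hx

theorem memLp_euclGradient_stripExt (ha : 0 < a) (hp : 1 < p) (hm : LipschitzWith Λm ηm)
    (hq : LipschitzWith Λp ηp) (hlt : ∀ y, ηm y < ηp y) (hfm : LocallyIntegrable fm)
    (hfp : LocallyIntegrable fp) (hfin : boundaryEnergy a p ηm ηp fm fp ≠ ⊤) :
    MemLp (euclGradient (stripExt a ηm ηp (fm, fp))) (ENNReal.ofReal p)
      (volume.restrict (stripDomain ηm ηp)) :=
  (memLp_stripMajorant ha hp hm.continuous hq.continuous hlt hfm hfp hfin).of_le_mul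
    (stronglyMeasurable_euclGradient _).aestronglyMeasurable
    ((norm_fderiv_stripExt_ae_le ha hm hq hfm hfp).mono fun x => (norm_euclGradient_le _ x).trans)

theorem locallyIntegrable_of_norm_le_mul {X F : Type*} [MeasurableSpace X] [TopologicalSpace X]
    [NormedAddCommGroup F] {μ : Measure X} {g : X → ℝ} {f : X → F} {C : ℝ}
    (hg : LocallyIntegrable g μ) (hf : AEStronglyMeasurable f μ)
    (hfg : ∀ᵐ x ∂μ, ‖f x‖ ≤ C * ‖g x‖) : LocallyIntegrable f μ := by
  refine (hg.smul C).mono hf (hfg.mono fun x hx => hx.trans ?_)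
  rw [Pi.smul_apply, norm_smul]
  exact mul_le_mul_of_nonneg_right (le_abs_self C) (norm_nonneg _)

theorem hasTrace_stripExt (ha : 0 < a) (hp : 1 < p) (hm : LipschitzWith Λm ηm)
    (hq : LipschitzWith Λp ηp) (hlt : ∀ y, ηm y < ηp y) (hfm : MemLpLoc p fm)
    (hfp : MemLpLoc p fp) (hfin : boundaryEnergy a p ηm ηp fm fp ≠ ⊤) :
    HasTrace p ηm ηp (stripExt a ηm ηp (fm, fp)) (euclGradient (stripExt a ηm ηp (fm, fp)))
      fm fp := by
  have hfmi := hfm.locallyIntegrable hp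
  have hfpi := hfp.locallyIntegrable hp
  have hΩ := (isOpen_stripDomain hm.continuous hq.continuous).measurableSet
  have hlip := locallyLipschitzOn_stripExt ha hm hq hfmi hfpi
  have hu := hlip.continuousOn.aestronglyMeasurable (μ := volume) hΩ
  have hQ := (memLp_stripMajorant ha hp hm.continuous hq.continuous hlt hfmi hfpi
    hfin).locallyIntegrable (by simpa using hp.le)
  have hquot : ∀ {f η : Horiz n → ℝ} {c : ℝ}, LocallyIntegrable f → Continuous η →
      (∀ x ∈ stripDomain ηm ηp, |(stripExt a ηm ηp (fm, fp) x - f x.1) / graphDepth c η x| ≤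
        extPointConst n a * stripMajorant a ηm ηp fm fp x) →
      LocallyIntegrable (fun x => (stripExt a ηm ηp (fm, fp) x - f x.1) / graphDepth c η x)
        (volume.restrict (stripDomain ηm ηp)) := fun hf hη hle =>
    locallyIntegrable_of_norm_le_mul hQ
      ((hu.sub (locallyIntegrable_comp_fst hf).aestronglyMeasurable.restrict).aemeasurable.div
        (measurable_graphDepth hη.measurable).aemeasurable).aestronglyMeasurable
      ((ae_restrict_mem hΩ).mono fun x hx => by
        rw [Real.norm_of_nonneg (stripMajorant_nonneg ha hx)]
        exact hle x hx)
  exact hasTrace_euclGradient hp hm hq hlt hfm hfp hlip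
    (locallyIntegrable_of_norm_le_mul hQ
      (measurable_fderiv ℝ _).stronglyMeasurable.aestronglyMeasurable
      (norm_fderiv_stripExt_ae_le ha hm hq hfmi hfpi))
    (hquot hfmi hm.continuous fun x => abs_stripExt_sub_lower_le ha hfmi hfpi)
    (hquot hfpi hq.continuous fun x => abs_stripExt_sub_upper_le ha hfmi hfpi)

/-- The constant in the energy estimate of the extension. -/
def extConst (n : ℕ) (a p : ℝ) : ℝ≥0 := (extPointConst n a).toNNReal ^ p * majorantConst n a p

theorem extConst_pos (n : ℕ) (ha : 0 < a) (p : ℝ) : 0 < extConst n a p :=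
  mul_pos (NNReal.rpow_pos (Real.toNNReal_pos.2 (extPointConst_pos n ha)))
    (mul_pos (NNReal.rpow_pos three_pos) (by positivity))

theorem gradEnergy_stripExt_le (ha : 0 < a) (hp : 1 < p) (hm : LipschitzWith Λm ηm)
    (hq : LipschitzWith Λp ηp) (hlt : ∀ y, ηm y < ηp y) (hfm : LocallyIntegrable fm)
    (hfp : LocallyIntegrable fp) :
    gradEnergy p (stripDomain ηm ηp) (euclGradient (stripExt a ηm ηp (fm, fp))) ≤
      extConst n a p * (1 + (Λm + Λp)) ^ p * boundaryEnergy a p ηm ηp fm fp := by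
  have hp0 : 0 ≤ p := (one_pos.trans hp).le
  have hpoint : ∀ᵐ x ∂volume.restrict (stripDomain ηm ηp),
      ‖euclGradient (stripExt a ηm ηp (fm, fp)) x‖ₑ ≤
        (extPointConst n a).toNNReal * (1 + (Λm + Λp)) *
          ENNReal.ofReal (stripMajorant a ηm ηp fm fp x) := by
    filter_upwards [ae_restrict_mem (isOpen_stripDomain hm.continuous
      hq.continuous).measurableSet] with x hx
    have hnorm := (norm_euclGradient_le _ x).trans (norm_fderiv_stripExt_le ha hm hq hfm hfp hx)
    have hC := (extPointConst_pos n ha).le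
    rw [← ofReal_norm]
    refine (ENNReal.ofReal_le_ofReal hnorm).trans_eq ?_
    rw [ENNReal.ofReal_mul (by positivity), ENNReal.ofReal_mul hC, ENNReal.ofReal_add zero_le_one
      (by positivity), ENNReal.ofReal_add Λm.coe_nonneg Λp.coe_nonneg]
    simp [ENNReal.ofReal]
  calc gradEnergy p (stripDomain ηm ηp) (euclGradient (stripExt a ηm ηp (fm, fp)))
      ≤ ∫⁻ x in stripDomain ηm ηp, ((extPointConst n a).toNNReal * (1 + (Λm + Λp))) ^ p *
          ENNReal.ofReal (stripMajorant a ηm ηp fm fp x) ^ p := by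
        refine lintegral_mono_ae (hpoint.mono fun x hx => ?_)
        rw [← ENNReal.mul_rpow_of_nonneg _ _ hp0]
        gcongr
    _ ≤ ((extPointConst n a).toNNReal * (1 + (Λm + Λp))) ^ p *
          (majorantConst n a p * boundaryEnergy a p ηm ηp fm fp) := by
        rw [lintegral_const_mul' _ _ (by finiteness)]
        gcongr
        exact lintegral_stripMajorant_rpow_le ha hp hm.continuous hq.continuous hlt hfm hfp
    _ = extConst n a p * (1 + (Λm + Λp)) ^ p * boundaryEnergy a p ηm ηp fm fp := by
        rw [extConst, ENNReal.mul_rpow_of_nonneg _ _ hp0, ENNReal.coe_mul,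
          ENNReal.coe_rpow_of_nonneg _ hp0]
        ring

theorem lipschitzWith_of_lipSeminorm_ne_top {η : Horiz n → ℝ} (h : lipSeminorm η ≠ ⊤) :
    LipschitzWith (lipSeminorm η).toNNReal η := by
  intro x y
  rw [ENNReal.coe_toNNReal h]
  rcases eq_or_ne x y with rfl | hxy
  · simp
  · rw [← ENNReal.div_le_iff (edist_pos.2 hxy).ne' (edist_ne_top x y)]
    exact le_iSup₂ (f := fun x y => edist (η x) (η y) / edist x y) x y

theorem screenedSeminorm_rpow {s : ℝ} (hp : p ≠ 0) (σ f : Horiz n → ℝ) :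
    screenedSeminorm s p σ f ^ p = screenedEnergy s p σ f := by
  rw [screenedSeminorm, ← ENNReal.rpow_mul, one_div_mul_cancel hp, ENNReal.rpow_one]

theorem boundaryEnergy_ne_top {hp : 1 < p} {hm : lipSeminorm ηm ≠ ⊤} {hq : lipSeminorm ηp ≠ ⊤}
    (f : boundaryData p a ηm ηp hp hm hq) : boundaryEnergy a p ηm ηp f.1.1 f.1.2 ≠ ⊤ := by
  obtain ⟨-, -, hdiff, hfm, hfp⟩ := f.2
  rw [screenedSeminorm_ne_top_iff hp] at hfm hfp
  exact ENNReal.add_ne_top.2 ⟨ENNReal.add_ne_top.2 ⟨hdiff, hfm⟩, hfp⟩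

theorem hasTrace_stripExt_boundaryData (ha : 0 < a) {hp : 1 < p} {hm : lipSeminorm ηm ≠ ⊤}
    {hq : lipSeminorm ηp ≠ ⊤} (hlt : ∀ y, ηm y < ηp y) (f : boundaryData p a ηm ηp hp hm hq) :
    HasTrace p ηm ηp (stripExt a ηm ηp f.1) (euclGradient (stripExt a ηm ηp f.1)) f.1.1 f.1.2 :=
  hasTrace_stripExt ha hp (lipschitzWith_of_lipSeminorm_ne_top hm)
    (lipschitzWith_of_lipSeminorm_ne_top hq) hlt f.2.1 f.2.2.1 (boundaryEnergy_ne_top f)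

theorem stripExt_mem_homSobolev (ha : 0 < a) {hp : 1 < p} {hm : lipSeminorm ηm ≠ ⊤}
    {hq : lipSeminorm ηp ≠ ⊤} (hlt : ∀ y, ηm y < ηp y) (f : boundaryData p a ηm ηp hp hm hq) :
    stripExt a ηm ηp f.1 ∈ homSobolev p (stripDomain ηm ηp) :=
  ⟨_, (hasTrace_stripExt_boundaryData ha hlt f).isWeakGradient
      (continuous_of_lipSeminorm_ne_top hm) (continuous_of_lipSeminorm_ne_top hq),
    memLp_euclGradient_stripExt ha hp (lipschitzWith_of_lipSeminorm_ne_top hm)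
      (lipschitzWith_of_lipSeminorm_ne_top hq) hlt (f.2.1.locallyIntegrable hp)
      (f.2.2.1.locallyIntegrable hp) (boundaryEnergy_ne_top f)⟩

/-- The linear extension operator from the boundary data to the homogeneous Sobolev space of the
strip, a right inverse of the trace. -/
def stripExtension (ha : 0 < a) (hp : 1 < p) (hm : lipSeminorm ηm ≠ ⊤) (hq : lipSeminorm ηp ≠ ⊤)
    (hlt : ∀ y, ηm y < ηp y) :
    boundaryData p a ηm ηp hp hm hq →ₗ[ℝ] homSobolev p (stripDomain ηm ηp) where
  toFun f := ⟨stripExt a ηm ηp f.1, stripExt_mem_homSobolev ha hlt f⟩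
  map_add' f g := Subtype.ext (stripExt_add (f.2.1.locallyIntegrable hp)
    (f.2.2.1.locallyIntegrable hp) (g.2.1.locallyIntegrable hp) (g.2.2.1.locallyIntegrable hp))
  map_smul' c f := Subtype.ext (stripExt_smul c f.1)

theorem gradEnergy_stripExt_boundaryData_le (ha : 0 < a) {hp : 1 < p}
    {hm : lipSeminorm ηm ≠ ⊤} {hq : lipSeminorm ηp ≠ ⊤} (hlt : ∀ y, ηm y < ηp y)
    (f : boundaryData p a ηm ηp hp hm hq) :
    gradEnergy p (stripDomain ηm ηp) (euclGradient (stripExt a ηm ηp f.1)) ≤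
      extConst n a p * (1 + (lipSeminorm ηm + lipSeminorm ηp)) ^ p *
        boundaryEnergy a p ηm ηp f.1.1 f.1.2 := by
  have hle := gradEnergy_stripExt_le ha hp (lipschitzWith_of_lipSeminorm_ne_top hm)
    (lipschitzWith_of_lipSeminorm_ne_top hq) hlt (f.2.1.locallyIntegrable hp)
    (f.2.2.1.locallyIntegrable hp)
  rwa [ENNReal.coe_toNNReal hm, ENNReal.coe_toNNReal hq] at hle

end Assembly

end

theorem theorem4p3_general (n : ℕ) (a p : ℝ) (ha0 : 0 < a) (hp : 1 < p) :
    ∃ c : ℝ≥0, 0 < c ∧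
      ∀ (ηm ηp : Horiz n → ℝ) (hm : lipSeminorm ηm ≠ ⊤) (hq : lipSeminorm ηp ≠ ⊤),
        (∀ x, ηm x < ηp x) →
        ∃ T : boundaryData p a ηm ηp hp hm hq →ₗ[ℝ] homSobolev p (stripDomain ηm ηp),
          ∀ f : boundaryData p a ηm ηp hp hm hq,
            ∃ G : Horiz n × ℝ → EVec n,
              IsWeakGradient (stripDomain ηm ηp) (T f : Horiz n × ℝ → ℝ) G ∧
              HasTrace p ηm ηp (T f : Horiz n × ℝ → ℝ) G f.1.1 f.1.2 ∧
              gradEnergy p (stripDomain ηm ηp) G ≤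
                c * (1 + (lipSeminorm ηm + lipSeminorm ηp)) ^ p *
                    weightedDiff p ηm ηp f.1.1 f.1.2
                  + c * (1 + (lipSeminorm ηm + lipSeminorm ηp)) ^ p *
                    screenedSeminorm (1 - 1 / p) p (stripScreen a ηm ηp) f.1.1 ^ p
                  + c * (1 + (lipSeminorm ηm + lipSeminorm ηp)) ^ p *
                    screenedSeminorm (1 - 1 / p) p (stripScreen a ηm ηp) f.1.2 ^ p := by
  refine ⟨extConst n a p, extConst_pos n ha0 p, fun ηm ηp hm hq hlt =>
    ⟨stripExtension ha0 hp hm hq hlt, fun f => ⟨euclGradient (stripExt a ηm ηp f.1), ?_⟩⟩⟩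
  have htrace := hasTrace_stripExt_boundaryData ha0 hlt f
  have hp0 : p ≠ 0 := (one_pos.trans hp).ne'
  refine ⟨htrace.isWeakGradient (continuous_of_lipSeminorm_ne_top hm)
    (continuous_of_lipSeminorm_ne_top hq), htrace, ?_⟩
  rw [screenedSeminorm_rpow hp0, screenedSeminorm_rpow hp0, ← mul_add, ← mul_add]
  exact gradEnergy_stripExt_boundaryData_le ha0 hlt f

theorem theorem4p3 (n : ℕ) (hn : 1 ≤ n) (a p : ℝ) (ha0 : 0 < a) (ha1 : a < 1) (hp : 1 < p) :
    ∃ c : ℝ≥0, 0 < c ∧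
      ∀ (ηm ηp : Horiz n → ℝ) (hm : lipSeminorm ηm ≠ ⊤) (hq : lipSeminorm ηp ≠ ⊤),
        (∀ x, ηm x < ηp x) →
        ∃ T : boundaryData p a ηm ηp hp hm hq →ₗ[ℝ] homSobolev p (stripDomain ηm ηp),
          ∀ f : boundaryData p a ηm ηp hp hm hq,
            ∃ G : Horiz n × ℝ → EVec n,
              IsWeakGradient (stripDomain ηm ηp) (T f : Horiz n × ℝ → ℝ) G ∧
              HasTrace p ηm ηp (T f : Horiz n × ℝ → ℝ) G f.1.1 f.1.2 ∧
              gradEnergy p (stripDomain ηm ηp) G ≤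
                c * (1 + (lipSeminorm ηm + lipSeminorm ηp)) ^ p *
                    weightedDiff p ηm ηp f.1.1 f.1.2
                  + c * (1 + (lipSeminorm ηm + lipSeminorm ηp)) ^ p *
                    screenedSeminorm (1 - 1 / p) p (stripScreen a ηm ηp) f.1.1 ^ p
                  + c * (1 + (lipSeminorm ηm + lipSeminorm ηp)) ^ p *
                    screenedSeminorm (1 - 1 / p) p (stripScreen a ηm ηp) f.1.2 ^ p :=
  theorem4p3_general n a p ha0 hp
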